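/- Let $d\ge 1$. Let $(\Omega,\mathcal F)$ be a measurable space with a measurable flow $(\theta_s)_{s\in\mathbb R^d}$ (that is, $(\omega,s)\mapsto\theta_s\omega$ is measurable, $\theta_0=\mathrm{id}$, $\theta_s\circ\theta_t=\theta_{s+t}$), and let $\mathbb P$ be a probability measure on $\Omega$ that is invariant under all $\theta_s$ and ergodic (every event invariant under all $\theta_s$ has probability $0$ or $1$). Let $\Phi,\Psi$ be ergodic random measures on $\mathbb R^d$ on this space, that is, measurable maps from $\Omega$ to the locally finite Borel measures on $\mathbb R^d$ with $\Phi_{\theta_s\omega}(B)=\Phi_\omega(B+s)$ and $\Psi_{\theta_s\omega}(B)=\Psi_\omega(B+s)$ for all $s,\omega$ and Borel $B$. Assume that they have the same intensity $\lambda\in(0,\infty)$: $\mathbb E[\Phi(B)]=\mathbb E[\Psi(B)]=\lambda\,\mathcal L_d(B)$ for all Borel $B$, where $\mathcal L_d$ is Lebesgue measure. **Site-optimal density.** For locally finite measures $\varphi,\psi$ on $\mathbb R^d$, let $R_0:=0$ on $\mathbb R^d\times\mathbb R^d$, let $B_a(x)$ be the closed Euclidean ball, and for $n=1,2,\dots$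 define $A_n,R_n:\mathbb R^d\times\mathbb R^d\to[0,1]$ as follows. (i) Let $a_n(x):=\sup\{a\ge 0:\int_{B_a(x)}(1-R_{n-1}(x,\xi))\,\psi(d\xi)\le 1\}\in[0,\infty]$ (with $\sup\emptyset=0$), and let $A_n(x,\xi)$ be $1$ if $|x-\xi|<a_n(x)$, $cR_{n-1}(x,\xi)+(1-c)$ if $|x-\xi|=a_n(x)$, and $0$ if $|x-\xi|>a_n(x)$. Here $c=c_n(x)\in[0,1]$ is the constant with $\int (A_n(x,\xi)-R_{n-1}(x,\xi))\,\psi(d\xi)=1$ if $a_n(x)<\infty$ and $\int_{\{|x-\xi|=a_n(x)\}}(1-R_{n-1}(x,\xi))\,\psi(d\xi)>0$, and $c=1$ otherwise. (ii) Let $r_n(\xi):=\sup\{r\ge 0:\int_{B_r(\xi)}A_n(x,\xi)\,\varphi(dx)\le 1\}\in[0,\infty]$ (with $\sup\emptyset=0$), and let $R_n(x,\xi)$ be $0$ if $|x-\xi|<r_n(\xi)$, $c'A_n(x,\xi)$ if $|x-\xi|=r_n(\xi)$, and $A_n(x,\xi)$ if $|x-\xi|>r_n(\xi)$. Here $c'=c'_n(\xi)\in[0,1]$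 is the constant with $\int (A_n(x,\xi)-R_n(x,\xi))\,\varphi(dx)=1$ if $r_n(\xi)<\infty$ and $\int_{\{|x-\xi|=r_n(\xi)\}}A_n(x,\xi)\,\varphi(dx)>0$, and $c'=0$ otherwise. The sequences $A_n$ and $R_n$ are non-decreasing in $n$; the site-optimal density of $(\varphi,\psi)$ is $f_s:=\lim_n A_n-\lim_n R_n$. **Theorem.** Let $F_\omega$ be the site-optimal density of $(\Phi_\omega,\Psi_\omega)$. Then almost surely $F_\omega$ is a balancing constrained density, that is, it is measurable on $\mathbb R^d\times\mathbb R^d$, $0\le F_\omega\le 1$ everywhere, $\int F_\omega(x,\xi)\,\Psi_\omega(d\xi)\le 1$ for every $x$ with equality for $\Phi_\omega$-a.e. $x$, and $\int F_\omega(x,\xi)\,\Phi_\omega(dx)\le 1$ for every $\xi$ with equality for $\Psi_\omega$-a.e. $\xi$. Moreover $(\omega,x,\xi)\mapsto F_\omega(x,\xi)$ is measurable and flow-adapted, $F_{\theta_s\omega}(x,\xi)=F_\omega(x+s,\xi+s)$. Consequently $$T_\omega(x,B):=\int_B F_\omega(x,\xi)\,\Psi_\omega(d\xi)$$ is measurable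 in $(\omega,x)$, is flow-adapted, $T_{\theta_s\omega}(x,B)=T_\omega(x+s,B+s)$, and is almost surely a $(\Phi_\omega,\Psi_\omega)$-balancing transport kernel: $x\mapsto T_\omega(x,\cdot)$ is a measurable map into the locally finite measures, $T_\omega(x,\mathbb R^d)=1$ for $\Phi_\omega$-a.e. $x$, and $\int T_\omega(x,B)\,\Phi_\omega(dx)=\Psi_\omega(B)$ for every Borel $B$. -/

import Mathlib

open MeasureTheory Filter Topology Set
open scoped ENNReal NNReal

noncomputable section

namespace GaleShapley

/-- `ℝ^d` with its Euclidean distance, Borel sigma-field and Lebesgue measure `volume`. -/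
abbrev Sp (d : ℕ) : Type := EuclideanSpace ℝ (Fin d)

variable {d : ℕ}

/-! ### The site-optimal Gale-Shapley algorithm

All weights lie in `[0, 1]`; they are coded in `ℝ≥0∞`, where no subtraction below ever truncates
(`R ≤ 1`, `R_n ≤ A_n` and `R_{n-1} ≤ A_n`). Radii take values in `[0, ∞]`. -/

/-- `sup {a : ∫_{closedBall x a} w dμ ≤ 1}`, in `[0, ∞]`; the supremum is `0` when `x` itself
already carries mass greater than `1`. -/
def fillRadius (μ : Measure (Sp d)) (w : Sp d → ℝ≥0∞) (x : Sp d) : ℝ≥0∞ :=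
  ⨆ (a : ℝ≥0) (_ : ∫⁻ y in Metric.closedBall x (a : ℝ), w y ∂μ ≤ 1), (a : ℝ≥0∞)

/-- The `w μ`-mass of the open ball whose radius is `fillRadius μ w x`. -/
def innerMass (μ : Measure (Sp d)) (w : Sp d → ℝ≥0∞) (x : Sp d) : ℝ≥0∞ :=
  ∫⁻ y in {y | edist y x < fillRadius μ w x}, w y ∂μ

/-- The `w μ`-mass of the sphere whose radius is `fillRadius μ w x`. -/
def sphereMass (μ : Measure (Sp d)) (w : Sp d → ℝ≥0∞) (x : Sp d) : ℝ≥0∞ :=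
  ∫⁻ y in {y | edist y x = fillRadius μ w x}, w y ∂μ

/-- The application radius of the site `x`, when the current rejection function is `R`. -/
def applicationRadius (ψ : Measure (Sp d)) (R : Sp d → Sp d → ℝ≥0∞) (x : Sp d) : ℝ≥0∞ :=
  fillRadius ψ (fun ξ => 1 - R x ξ) x

/-- The constant `c ∈ [0, 1]` that makes the new applications of `x` have total mass `1` (see
`lintegral_applicationStep`), and `1` where no such constant is determined. -/
def applicationConst (ψ : Measure (Sp d)) (R : Sp d → Sp d → ℝ≥0∞) (x : Sp d) : ℝ≥0∞ :=
  if applicationRadius ψ R x = ∞ ∨ sphereMass ψ (fun ξ => 1 - R x ξ) x = 0 then 1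
  else 1 - (1 - innerMass ψ (fun ξ => 1 - R x ξ) x) / sphereMass ψ (fun ξ => 1 - R x ξ) x

/-- Step (i) of a stage: the application function obtained from the rejection function `R`. -/
def applicationStep (ψ : Measure (Sp d)) (R : Sp d → Sp d → ℝ≥0∞) (x ξ : Sp d) : ℝ≥0∞ :=
  if edist ξ x < applicationRadius ψ R x then 1
  else if edist ξ x = applicationRadius ψ R x then
    applicationConst ψ R x * R x ξ + (1 - applicationConst ψ R x)
  else 0

/-- The rejection radius of the center `ξ`, when the current application function is `A`. -/
def rejectionRadius (φ : Measure (Sp d)) (A : Sp d → Sp d → ℝ≥0∞) (ξ : Sp d) : ℝ≥0∞ :=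
  fillRadius φ (fun x => A x ξ) ξ

/-- The constant `c' ∈ [0, 1]` that makes the applications kept by `ξ` have total mass `1` (see
`lintegral_rejectionStep`), and `0` where no such constant is determined. -/
def rejectionConst (φ : Measure (Sp d)) (A : Sp d → Sp d → ℝ≥0∞) (ξ : Sp d) : ℝ≥0∞ :=
  if rejectionRadius φ A ξ = ∞ ∨ sphereMass φ (fun x => A x ξ) ξ = 0 then 0
  else 1 - (1 - innerMass φ (fun x => A x ξ) ξ) / sphereMass φ (fun x => A x ξ) ξ

/-- Step (ii) of a stage: the rejection function obtained from the application function `A`. -/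
def rejectionStep (φ : Measure (Sp d)) (A : Sp d → Sp d → ℝ≥0∞) (x ξ : Sp d) : ℝ≥0∞ :=
  if edist x ξ < rejectionRadius φ A ξ then 0
  else if edist x ξ = rejectionRadius φ A ξ then rejectionConst φ A ξ * A x ξ
  else A x ξ

/-- The rejection function `R_n` after `n` stages. -/
def rejectionFn (φ ψ : Measure (Sp d)) : ℕ → Sp d → Sp d → ℝ≥0∞
  | 0 => fun _ _ => 0
  | n + 1 => rejectionStep φ (applicationStep ψ (rejectionFn φ ψ n))

/-- `applicationFn φ ψ n` is the application function `A_{n+1}` of stage `n + 1`. -/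
def applicationFn (φ ψ : Measure (Sp d)) (n : ℕ) : Sp d → Sp d → ℝ≥0∞ :=
  applicationStep ψ (rejectionFn φ ψ n)

/-- The final application function, the pointwise limit of the `A_n`. -/
def finalApplication (φ ψ : Measure (Sp d)) (x ξ : Sp d) : ℝ≥0∞ :=
  limUnder atTop (fun n => applicationFn φ ψ n x ξ)

/-- The final rejection function, the pointwise limit of the `R_n`. -/
def finalRejection (φ ψ : Measure (Sp d)) (x ξ : Sp d) : ℝ≥0∞ :=
  limUnder atTop (fun n => rejectionFn φ ψ n x ξ)

/-- The site-optimal density `f_s = A - R`. -/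
def siteOptimalDensity (φ ψ : Measure (Sp d)) (x ξ : Sp d) : ℝ≥0∞ :=
  finalApplication φ ψ x ξ - finalRejection φ ψ x ξ

/-! ### The constants and the limits exist

The constants in the two steps do satisfy their defining equations, and the sequences
`A_n`, `R_n` are monotone, so that the limits above exist. -/

lemma measurableSet_inner (x : Sp d) (a : ℝ≥0∞) : MeasurableSet {y | edist y x < a} :=
  measurableSet_lt (by fun_prop) measurable_const

lemma measurableSet_sphere (x : Sp d) (a : ℝ≥0∞) : MeasurableSet {y | edist y x = a} :=
  measurableSet_eq_fun (by fun_prop) measurable_const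

lemma innerMass_le_one (μ : Measure (Sp d)) (w : Sp d → ℝ≥0∞) (x : Sp d) :
    innerMass μ w x ≤ 1 := by
  unfold innerMass
  rcases eq_or_ne (fillRadius μ w x) 0 with h0 | h0
  · simp [h0]
  obtain ⟨u, hu, hlt, hlim⟩ := exists_seq_strictMono_tendsto' (pos_iff_ne_zero.2 h0)
  have hset : {y | edist y x < fillRadius μ w x} = ⋃ n, {y | edist y x ≤ u n} := by
    ext y
    simp only [mem_ofPred_eq, mem_iUnion]
    constructor
    · intro hy
      obtain ⟨n, hn⟩ := (hlim.eventually (lt_mem_nhds hy)).exists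
      exact ⟨n, hn.le⟩
    · rintro ⟨n, hn⟩
      exact hn.trans_lt (hlt n).2
  have hm : ∀ n, MeasurableSet {y | edist y x ≤ u n} := fun n =>
    measurableSet_le (by fun_prop) measurable_const
  rw [hset, ← withDensity_apply w (MeasurableSet.iUnion hm),
    (Monotone.directed_le (f := fun n => {y | edist y x ≤ u n}) (fun m n hmn y hy =>
      le_trans (show edist y x ≤ u m from hy) (hu.monotone hmn))).measure_iUnion]
  refine iSup_le fun n => ?_
  rw [withDensity_apply w (hm n)]
  obtain ⟨a, ha⟩ := lt_iSup_iff.1 (hlt n).2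
  obtain ⟨h1, h2⟩ := lt_iSup_iff.1 ha
  refine le_trans (lintegral_mono_set fun y hy => ?_) h1
  have : edist y x ≤ a := le_trans (show edist y x ≤ u n from hy) h2.le
  rw [edist_nndist] at this
  exact_mod_cast this

lemma one_le_innerMass_add (μ : Measure (Sp d)) [IsLocallyFiniteMeasure μ] (w : Sp d → ℝ≥0∞)
    (hw : ∀ y, w y ≤ 1) (x : Sp d) (hr : fillRadius μ w x ≠ ∞) :
    1 ≤ innerMass μ w x + sphereMass μ w x := by
  have hadd : innerMass μ w x + sphereMass μ w x
      = μ.withDensity w {y | edist y x ≤ fillRadius μ w x} := by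
    unfold innerMass sphereMass
    rw [← withDensity_apply w (measurableSet_inner _ _),
      ← withDensity_apply w (measurableSet_sphere _ _), ← measure_union _ (measurableSet_sphere _ _)]
    · congr 1; ext y; simp [le_iff_lt_or_eq]
    · rw [Set.disjoint_left]
      intro y hy hy2
      exact (ne_of_lt hy) hy2
  rw [hadd]
  obtain ⟨b, hb⟩ : ∃ b : ℝ≥0, (b : ℝ≥0∞) = fillRadius μ w x := ⟨_, ENNReal.coe_toNNReal hr⟩
  obtain ⟨u, hu, hlt, hlim⟩ := exists_seq_strictAnti_tendsto b
  have hset : {y | edist y x ≤ fillRadius μ w x} = ⋂ n, Metric.closedBall x (u n : ℝ) := by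
    ext y
    rw [← hb]
    simp only [mem_ofPred_eq, mem_iInter, Metric.mem_closedBall, edist_nndist]
    constructor
    · intro h n
      have h' : nndist y x ≤ b := by exact_mod_cast h
      exact_mod_cast h'.trans (hlt n).le
    · intro h
      have : nndist y x ≤ b := ge_of_tendsto' hlim fun n => by exact_mod_cast h n
      exact_mod_cast this
  rw [hset, Antitone.measure_iInter]
  · refine le_iInf fun n => ?_
    rw [withDensity_apply w measurableSet_closedBall]
    by_contra hcon
    have h1 : ((u n : ℝ≥0) : ℝ≥0∞) ≤ fillRadius μ w x :=
      le_iSup₂_of_le (u n) (not_le.1 hcon).le le_rfl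
    rw [← hb] at h1
    exact absurd (hlt n) (not_lt.2 (by exact_mod_cast h1))
  · intro m n hmn
    exact Metric.closedBall_subset_closedBall (by exact_mod_cast hu.antitone hmn)
  · exact fun n => measurableSet_closedBall.nullMeasurableSet
  · refine ⟨0, ?_⟩
    rw [withDensity_apply w measurableSet_closedBall]
    refine ne_top_of_le_ne_top (measure_closedBall_lt_top (μ := μ) (x := x) (r := (u 0 : ℝ))).ne ?_
    calc ∫⁻ y in Metric.closedBall x (u 0 : ℝ), w y ∂μ
        ≤ ∫⁻ y in Metric.closedBall x (u 0 : ℝ), 1 ∂μ := lintegral_mono fun y => hw y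
      _ = μ (Metric.closedBall x (u 0 : ℝ)) := by simp

lemma applicationConst_le_one (ψ : Measure (Sp d)) (R : Sp d → Sp d → ℝ≥0∞) (x : Sp d) :
    applicationConst ψ R x ≤ 1 := by
  unfold applicationConst; split_ifs
  · exact le_rfl
  · exact tsub_le_self

lemma rejectionConst_le_one (φ : Measure (Sp d)) (A : Sp d → Sp d → ℝ≥0∞) (ξ : Sp d) :
    rejectionConst φ A ξ ≤ 1 := by
  unfold rejectionConst; split_ifs
  · exact zero_le_one
  · exact tsub_le_self

lemma lintegral_split (μ : Measure (Sp d)) (w g : Sp d → ℝ≥0∞) (x : Sp d) (a c : ℝ≥0∞)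
    (hc : c ≠ ∞) (h1 : ∀ y, edist y x < a → g y = w y) (h2 : ∀ y, edist y x = a → g y = c * w y)
    (h3 : ∀ y, a < edist y x → g y = 0) :
    ∫⁻ y, g y ∂μ = (∫⁻ y in {y | edist y x < a}, w y ∂μ)
      + c * ∫⁻ y in {y | edist y x = a}, w y ∂μ := by
  rw [← lintegral_add_compl g (measurableSet_inner x a)]
  congr 1
  · exact setLIntegral_congr_fun (measurableSet_inner x a) h1
  · rw [← lintegral_inter_add_sdiff g _ (measurableSet_sphere x a),
      setLIntegral_congr_fun (g := fun _ => 0) (((measurableSet_inner x a).compl).diff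
        (measurableSet_sphere x a)), lintegral_zero, add_zero,
      ← lintegral_const_mul' c _ hc]
    · have : {y | edist y x < a}ᶜ ∩ {y | edist y x = a} = {y | edist y x = a} := by
        ext y; simp +contextual
      rw [this]
      exact setLIntegral_congr_fun (measurableSet_sphere x a) h2
    · intro y hy
      simp only [Set.mem_sdiff, mem_compl_iff, mem_ofPred_eq, not_lt] at hy
      exact h3 y (lt_of_le_of_ne hy.1 (Ne.symm hy.2))

lemma frac_le_one (μ : Measure (Sp d)) [IsLocallyFiniteMeasure μ] (w : Sp d → ℝ≥0∞)
    (hw : ∀ y, w y ≤ 1) (x : Sp d) (hr : fillRadius μ w x ≠ ∞) :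
    (1 - innerMass μ w x) / sphereMass μ w x ≤ 1 :=
  ENNReal.div_le_of_le_mul (by
    rw [one_mul]; exact tsub_le_iff_left.2 (one_le_innerMass_add μ w hw x hr))

lemma sphereMass_ne_top (μ : Measure (Sp d)) [IsLocallyFiniteMeasure μ] (w : Sp d → ℝ≥0∞)
    (hw : ∀ y, w y ≤ 1) (x : Sp d) (hr : fillRadius μ w x ≠ ∞) : sphereMass μ w x ≠ ∞ := by
  unfold sphereMass
  obtain ⟨b, hb⟩ : ∃ b : ℝ≥0, (b : ℝ≥0∞) = fillRadius μ w x := ⟨_, ENNReal.coe_toNNReal hr⟩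
  refine ne_top_of_le_ne_top (measure_closedBall_lt_top (μ := μ) (x := x) (r := (b : ℝ))).ne ?_
  calc ∫⁻ y in {y | edist y x = fillRadius μ w x}, w y ∂μ
      ≤ ∫⁻ y in {y | edist y x = fillRadius μ w x}, 1 ∂μ := lintegral_mono fun y => hw y
    _ = μ {y | edist y x = fillRadius μ w x} := by simp
    _ ≤ _ := measure_mono fun y hy => by
        have : edist y x = b := by rw [hb]; exact hy
        rw [edist_nndist] at this
        have h' : nndist y x = b := by exact_mod_cast this
        rw [Metric.mem_closedBall, ← h']; rfl

lemma inner_add_frac (μ : Measure (Sp d)) [IsLocallyFiniteMeasure μ] (w : Sp d → ℝ≥0∞)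
    (hw : ∀ y, w y ≤ 1) (x : Sp d) (hr : fillRadius μ w x ≠ ∞) :
    innerMass μ w x + (1 - innerMass μ w x) / sphereMass μ w x * sphereMass μ w x = 1 := by
  have hi := innerMass_le_one μ w x
  have hs := one_le_innerMass_add μ w hw x hr
  rcases eq_or_ne (sphereMass μ w x) 0 with h0 | h0
  · rw [h0, add_zero] at hs; rw [h0, mul_zero, add_zero]; exact le_antisymm hi hs
  · rw [ENNReal.div_mul_cancel h0 (sphereMass_ne_top μ w hw x hr), add_tsub_cancel_of_le hi]

/-- The defining equation of the constant in the application step. -/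
lemma lintegral_applicationStep (ψ : Measure (Sp d)) [IsLocallyFiniteMeasure ψ]
    (R : Sp d → Sp d → ℝ≥0∞) (hR : ∀ x ξ, R x ξ ≤ 1) (x : Sp d)
    (hr : applicationRadius ψ R x ≠ ∞) :
    ∫⁻ ξ, (applicationStep ψ R x ξ - R x ξ) ∂ψ = 1 := by
  have hc1 := applicationConst_le_one ψ R x
  rw [lintegral_split ψ (fun ξ => 1 - R x ξ) _ x (applicationRadius ψ R x)
    (1 - applicationConst ψ R x) (ENNReal.sub_ne_top ENNReal.one_ne_top)]
  · change innerMass ψ (fun ξ => 1 - R x ξ) x + _ * sphereMass ψ (fun ξ => 1 - R x ξ) x = 1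
    have hw : ∀ ξ, 1 - R x ξ ≤ 1 := fun ξ => tsub_le_self
    have key := inner_add_frac ψ _ hw x hr
    by_cases h0 : sphereMass ψ (fun ξ => 1 - R x ξ) x = 0
    · rw [h0, mul_zero] at key ⊢; exact key
    · rw [applicationConst, if_neg (by simp [hr, h0]), ENNReal.sub_sub_cancel ENNReal.one_ne_top
        (frac_le_one ψ _ hw x hr)]
      exact key
  · intro ξ h; simp [applicationStep, h]
  · intro ξ h
    simp only [applicationStep, h, lt_irrefl, if_false, if_true]
    have hR1 := hR x ξ
    lift R x ξ to ℝ≥0 using ne_top_of_le_ne_top ENNReal.one_ne_top hR1 with ρ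
    lift applicationConst ψ R x to ℝ≥0 using ne_top_of_le_ne_top ENNReal.one_ne_top hc1 with c
    norm_cast at hR1 hc1 ⊢
    rw [← NNReal.coe_inj]
    rw [NNReal.coe_sub, NNReal.coe_mul, NNReal.coe_sub hR1, NNReal.coe_sub hc1]
    · push_cast [NNReal.coe_sub hc1]; ring
    · rw [← NNReal.coe_le_coe]; push_cast [NNReal.coe_sub hc1]
      have a1 : (ρ : ℝ) ≤ 1 := by exact_mod_cast hR1
      have a2 : (c : ℝ) ≤ 1 := by exact_mod_cast hc1
      nlinarith
  · intro ξ h; simp [applicationStep, h.not_gt, h.ne']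

/-- The defining equation of the constant in the rejection step. -/
lemma lintegral_rejectionStep (φ : Measure (Sp d)) [IsLocallyFiniteMeasure φ]
    (A : Sp d → Sp d → ℝ≥0∞) (hA : ∀ x ξ, A x ξ ≤ 1) (ξ : Sp d)
    (hr : rejectionRadius φ A ξ ≠ ∞) :
    ∫⁻ x, (A x ξ - rejectionStep φ A x ξ) ∂φ = 1 := by
  rw [lintegral_split φ (fun x => A x ξ) _ ξ (rejectionRadius φ A ξ)
    (1 - rejectionConst φ A ξ) (ENNReal.sub_ne_top ENNReal.one_ne_top)]
  · change innerMass φ (fun x => A x ξ) ξ + _ * sphereMass φ (fun x => A x ξ) ξ = 1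
    have hw : ∀ x, A x ξ ≤ 1 := fun x => hA x ξ
    have key := inner_add_frac φ _ hw ξ hr
    by_cases h0 : sphereMass φ (fun x => A x ξ) ξ = 0
    · rw [h0, mul_zero] at key ⊢; exact key
    · rw [rejectionConst, if_neg (by simp [hr, h0]), ENNReal.sub_sub_cancel ENNReal.one_ne_top
        (frac_le_one φ _ hw ξ hr)]
      exact key
  · intro x h; simp [rejectionStep, h]
  · intro x h
    simp only [rejectionStep, h, lt_irrefl, if_false, if_true]
    rw [ENNReal.sub_mul (fun _ _ => ne_top_of_le_ne_top ENNReal.one_ne_top (hA x ξ)), one_mul]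
  · intro x h; simp [rejectionStep, h.not_gt, h.ne']

lemma fillRadius_anti (μ : Measure (Sp d)) {w w' : Sp d → ℝ≥0∞} (h : ∀ y, w y ≤ w' y)
    (x : Sp d) : fillRadius μ w' x ≤ fillRadius μ w x :=
  iSup₂_le fun a ha => le_iSup₂_of_le a ((lintegral_mono fun y => h y).trans ha) le_rfl

lemma frac_anti (μ : Measure (Sp d)) {w w' : Sp d → ℝ≥0∞} (h : ∀ y, w y ≤ w' y) (x : Sp d)
    (hr : fillRadius μ w' x = fillRadius μ w x) :
    (1 - innerMass μ w' x) / sphereMass μ w' x ≤ (1 - innerMass μ w x) / sphereMass μ w x := by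
  refine ENNReal.div_le_div (tsub_le_tsub_left ?_ _) ?_
  · unfold innerMass; rw [hr]; exact lintegral_mono fun y => h y
  · unfold sphereMass; rw [hr]; exact lintegral_mono fun y => h y

lemma applicationStep_le_one (ψ : Measure (Sp d)) (R : Sp d → Sp d → ℝ≥0∞)
    (hR : ∀ x ξ, R x ξ ≤ 1) (x ξ : Sp d) : applicationStep ψ R x ξ ≤ 1 := by
  unfold applicationStep
  split_ifs
  · exact le_rfl
  · calc _ ≤ applicationConst ψ R x * 1 + (1 - applicationConst ψ R x) := by
          gcongr; exact hR x ξ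
      _ = 1 := by rw [mul_one, add_tsub_cancel_of_le (applicationConst_le_one ψ R x)]
  · exact zero_le_one

lemma rejectionStep_le (φ : Measure (Sp d)) (A : Sp d → Sp d → ℝ≥0∞) (x ξ : Sp d) :
    rejectionStep φ A x ξ ≤ A x ξ := by
  unfold rejectionStep
  split_ifs
  · exact zero_le
  · exact mul_le_of_le_one_left zero_le (rejectionConst_le_one φ A ξ)
  · exact le_rfl

lemma applicationConst_anti (ψ : Measure (Sp d)) [IsLocallyFiniteMeasure ψ]
    {R R' : Sp d → Sp d → ℝ≥0∞} (h : ∀ x ξ, R x ξ ≤ R' x ξ) (x : Sp d)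
    (hr : applicationRadius ψ R x = applicationRadius ψ R' x)
    (hfin : applicationRadius ψ R x ≠ ∞) :
    applicationConst ψ R' x ≤ applicationConst ψ R x := by
  have hw : ∀ y, 1 - R' x y ≤ 1 - R x y := fun y => tsub_le_tsub_left (h x y) _
  by_cases h0 : sphereMass ψ (fun ξ => 1 - R x ξ) x = 0
  · rw [applicationConst.eq_def ψ R, if_pos (Or.inr h0)]
    exact applicationConst_le_one ψ R' x
  · rw [applicationConst.eq_def ψ R, if_neg (by simp [h0, hfin])]
    have hfr := frac_anti ψ hw x hr
    by_cases h0' : sphereMass ψ (fun ξ => 1 - R' x ξ) x = 0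
    · have h1 := one_le_innerMass_add ψ (fun ξ => 1 - R' x ξ) (fun _ => tsub_le_self) x
        (by rw [applicationRadius, applicationRadius] at hr; rw [← hr]; exact hfin)
      rw [h0', add_zero] at h1
      have h2 : innerMass ψ (fun ξ => 1 - R' x ξ) x ≤ innerMass ψ (fun ξ => 1 - R x ξ) x := by
        unfold innerMass; rw [applicationRadius, applicationRadius] at hr; rw [hr]
        exact lintegral_mono fun y => hw y
      rw [tsub_eq_zero_of_le (h1.trans h2), ENNReal.zero_div, tsub_zero]
      exact applicationConst_le_one ψ R' x
    · rw [applicationConst, if_neg (by simp [h0', ← hr, hfin])]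
      exact tsub_le_tsub_left hfr _

lemma applicationStep_mono (ψ : Measure (Sp d)) [IsLocallyFiniteMeasure ψ]
    {R R' : Sp d → Sp d → ℝ≥0∞} (h : ∀ x ξ, R x ξ ≤ R' x ξ) (hR' : ∀ x ξ, R' x ξ ≤ 1)
    (x ξ : Sp d) : applicationStep ψ R x ξ ≤ applicationStep ψ R' x ξ := by
  have hR : ∀ x ξ, R x ξ ≤ 1 := fun x ξ => (h x ξ).trans (hR' x ξ)
  have hle : applicationRadius ψ R x ≤ applicationRadius ψ R' x :=
    fillRadius_anti ψ (fun y => tsub_le_tsub_left (h x y) _) x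
  rcases lt_trichotomy (edist ξ x) (applicationRadius ψ R' x) with h1 | h1 | h1
  · rw [applicationStep.eq_def ψ R', if_pos h1]; exact applicationStep_le_one ψ R hR x ξ
  · rcases hle.lt_or_eq with h2 | h2
    · rw [applicationStep, if_neg (by rw [h1]; exact h2.not_gt), if_neg (by rw [h1]; exact h2.ne')]
      exact zero_le
    · have hfin : applicationRadius ψ R x ≠ ∞ := by rw [h2, ← h1]; exact edist_ne_top _ _
      have hc := applicationConst_anti ψ h x h2 hfin
      have hc1 := applicationConst_le_one ψ R x
      simp only [applicationStep, h1, h2, lt_irrefl, if_false, if_true]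
      calc applicationConst ψ R x * R x ξ + (1 - applicationConst ψ R x)
          ≤ applicationConst ψ R x * R' x ξ + (1 - applicationConst ψ R x) := by
            gcongr; exact h x ξ
        _ = applicationConst ψ R' x * R' x ξ
              + ((applicationConst ψ R x - applicationConst ψ R' x) * R' x ξ
              + (1 - applicationConst ψ R x)) := by
            rw [← add_assoc, ← add_mul, add_tsub_cancel_of_le hc]
        _ ≤ applicationConst ψ R' x * R' x ξ
              + ((applicationConst ψ R x - applicationConst ψ R' x) * 1
              + (1 - applicationConst ψ R x)) := by
            gcongr; exact hR' x ξ
        _ = _ := by rw [mul_one, add_comm (_ - _) (1 - _), tsub_add_tsub_cancel hc1 hc]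
  · have h2 := hle.trans_lt h1
    rw [applicationStep, if_neg h2.not_gt, if_neg h2.ne']; exact zero_le

lemma rejectionConst_mono (φ : Measure (Sp d))
    {A A' : Sp d → Sp d → ℝ≥0∞} (h : ∀ x ξ, A x ξ ≤ A' x ξ) (ξ : Sp d)
    (hr : rejectionRadius φ A' ξ = rejectionRadius φ A ξ) :
    rejectionConst φ A ξ ≤ rejectionConst φ A' ξ := by
  rw [rejectionConst.eq_def φ A]
  split_ifs with h0
  · exact zero_le
  · push Not at h0
    have hs : sphereMass φ (fun x => A x ξ) ξ ≤ sphereMass φ (fun x => A' x ξ) ξ := by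
      unfold sphereMass; rw [rejectionRadius, rejectionRadius] at hr; rw [hr]
      exact lintegral_mono fun y => h y ξ
    have h0' : sphereMass φ (fun x => A' x ξ) ξ ≠ 0 := fun hz =>
      h0.2 (le_antisymm (hs.trans hz.le) zero_le)
    rw [rejectionConst, if_neg (by simp [h0', hr, h0.1])]
    exact tsub_le_tsub_left (frac_anti φ (fun y => h y ξ) ξ hr) _

lemma rejectionStep_mono (φ : Measure (Sp d))
    {A A' : Sp d → Sp d → ℝ≥0∞} (h : ∀ x ξ, A x ξ ≤ A' x ξ) (x ξ : Sp d) :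
    rejectionStep φ A x ξ ≤ rejectionStep φ A' x ξ := by
  have hle : rejectionRadius φ A' ξ ≤ rejectionRadius φ A ξ :=
    fillRadius_anti φ (fun y => h y ξ) ξ
  rcases lt_trichotomy (edist x ξ) (rejectionRadius φ A' ξ) with h1 | h1 | h1
  · rw [rejectionStep, if_pos (h1.trans_le hle)]; exact zero_le
  · rcases hle.lt_or_eq with h2 | h2
    · rw [rejectionStep, if_pos (h1.trans_lt h2)]; exact zero_le
    · simp only [rejectionStep, h1, h2, lt_irrefl, if_false, if_true]
      exact mul_le_mul' (rejectionConst_mono φ h ξ h2) (h x ξ)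
  · rw [rejectionStep.eq_def φ A', if_neg h1.not_gt, if_neg h1.ne']
    exact (rejectionStep_le φ A x ξ).trans (h x ξ)

lemma rejectionFn_le_one (φ ψ : Measure (Sp d)) (n : ℕ) (x ξ : Sp d) :
    rejectionFn φ ψ n x ξ ≤ 1 := by
  induction n generalizing x ξ with
  | zero => exact zero_le
  | succ n ih => exact (rejectionStep_le _ _ _ _).trans (applicationStep_le_one ψ _ ih x ξ)

lemma rejectionFn_le_succ (φ ψ : Measure (Sp d)) [IsLocallyFiniteMeasure ψ]
    (n : ℕ) (x ξ : Sp d) : rejectionFn φ ψ n x ξ ≤ rejectionFn φ ψ (n + 1) x ξ := by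
  induction n generalizing x ξ with
  | zero => exact zero_le
  | succ n ih =>
    exact rejectionStep_mono φ
      (fun x ξ => applicationStep_mono ψ ih (rejectionFn_le_one φ ψ (n + 1)) x ξ) x ξ

lemma rejectionFn_monotone (φ ψ : Measure (Sp d)) [IsLocallyFiniteMeasure ψ] (x ξ : Sp d) :
    Monotone fun n => rejectionFn φ ψ n x ξ :=
  monotone_nat_of_le_succ fun n => rejectionFn_le_succ φ ψ n x ξ

lemma applicationFn_monotone (φ ψ : Measure (Sp d)) [IsLocallyFiniteMeasure ψ] (x ξ : Sp d) :
    Monotone fun n => applicationFn φ ψ n x ξ :=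
  monotone_nat_of_le_succ fun n => applicationStep_mono ψ (rejectionFn_le_succ φ ψ n)
    (rejectionFn_le_one φ ψ (n + 1)) x ξ

/-- The limit of the rejection functions exists. -/
lemma tendsto_finalRejection (φ ψ : Measure (Sp d)) [IsLocallyFiniteMeasure ψ] (x ξ : Sp d) :
    Tendsto (fun n => rejectionFn φ ψ n x ξ) atTop (𝓝 (finalRejection φ ψ x ξ)) :=
  tendsto_nhds_limUnder ⟨_, tendsto_atTop_iSup (rejectionFn_monotone φ ψ x ξ)⟩

/-- The limit of the application functions exists. -/
lemma tendsto_finalApplication (φ ψ : Measure (Sp d)) [IsLocallyFiniteMeasure ψ] (x ξ : Sp d) :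
    Tendsto (fun n => applicationFn φ ψ n x ξ) atTop (𝓝 (finalApplication φ ψ x ξ)) :=
  tendsto_nhds_limUnder ⟨_, tendsto_atTop_iSup (applicationFn_monotone φ ψ x ξ)⟩

/-! ### Densities and transport kernels -/

/-- Sub-balancing densities for `φ` and `ψ`. -/
structure IsSubBalancing (φ ψ : Measure (Sp d)) (f : Sp d → Sp d → ℝ≥0∞) : Prop where
  measurable : Measurable (Function.uncurry f)
  site_le : ∀ x, ∫⁻ ξ, f x ξ ∂ψ ≤ 1
  center_le : ∀ ξ, ∫⁻ x, f x ξ ∂φ ≤ 1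

/-- Balancing densities for `φ` and `ψ`. -/
structure IsBalancing (φ ψ : Measure (Sp d)) (f : Sp d → Sp d → ℝ≥0∞) : Prop
    extends IsSubBalancing φ ψ f where
  site_eq : ∀ᵐ x ∂φ, ∫⁻ ξ, f x ξ ∂ψ = 1
  center_eq : ∀ᵐ ξ ∂ψ, ∫⁻ x, f x ξ ∂φ = 1

/-- Constrained densities for `φ` and `ψ`. -/
structure IsConstrained (φ ψ : Measure (Sp d)) (f : Sp d → Sp d → ℝ≥0∞) : Prop
    extends IsSubBalancing φ ψ f where
  le_one : ∀ x ξ, f x ξ ≤ 1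

/-- The kernel `T(x, B) = ∫_B f(x, ξ) ψ(dξ)` of a density. -/
def densityKernel (ψ : Measure (Sp d)) (f : Sp d → Sp d → ℝ≥0∞) (x : Sp d) : Measure (Sp d) :=
  ψ.withDensity (f x)

/-- `T` is a `(φ, ψ)`-balancing transport kernel: a measurable map into the locally finite
measures, Markovian for `φ`-almost every point, transporting `φ` to `ψ`. -/
structure IsBalancingTransportKernel (φ ψ : Measure (Sp d)) (T : Sp d → Measure (Sp d)) :
    Prop where
  measurable : Measurable T
  locallyFinite : ∀ x, IsLocallyFiniteMeasure (T x)
  markov : ∀ᵐ x ∂φ, T x univ = 1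
  balancing : ∀ B : Set (Sp d), MeasurableSet B → ∫⁻ x, T x B ∂φ = ψ B

/-! ### Flows and random measures -/

/-- A measurable flow indexed by `ℝ^d`. -/
structure MeasurableFlow (d : ℕ) (Ω : Type*) [MeasurableSpace Ω] where
  toFun : Sp d → Ω → Ω
  measurable' : Measurable fun p : Ω × Sp d => toFun p.2 p.1
  zero' : toFun 0 = id
  add' : ∀ s t, toFun s ∘ toFun t = toFun (s + t)

instance {Ω : Type*} [MeasurableSpace Ω] :
    CoeFun (MeasurableFlow d Ω) (fun _ => Sp d → Ω → Ω) := ⟨MeasurableFlow.toFun⟩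

/-- The shift of measures, `(θ_s μ)(B) = μ(B + s)`. -/
def shiftMeasure (s : Sp d) (μ : Measure (Sp d)) : Measure (Sp d) :=
  μ.map (fun x => x - s)

/-- `(ℙ, Φ)` is an ergodic (stationary) random measure on `ℝ^d`. -/
structure IsErgodicRandomMeasure {Ω : Type*} [MeasurableSpace Ω] (θ : MeasurableFlow d Ω)
    (ℙ : Measure Ω) (Φ : Ω → Measure (Sp d)) : Prop where
  isProbability : IsProbabilityMeasure ℙ
  measurable : Measurable Φ
  locallyFinite : ∀ ω, IsLocallyFiniteMeasure (Φ ω)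
  flowAdapted : ∀ s ω, Φ (θ s ω) = shiftMeasure s (Φ ω)
  stationary : ∀ s, ℙ.map (θ s) = ℙ
  ergodic : ∀ S : Set Ω, MeasurableSet S → (∀ s, θ s ⁻¹' S = S) → ℙ S = 0 ∨ ℙ S = 1

/-- `lam` is the intensity of `(ℙ, Φ)`. -/
def HasIntensity {Ω : Type*} [MeasurableSpace Ω] (ℙ : Measure Ω) (Φ : Ω → Measure (Sp d))
    (lam : ℝ≥0∞) : Prop :=
  ∀ B : Set (Sp d), MeasurableSet B → ∫⁻ ω, Φ ω B ∂ℙ = lam * volume B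

/-- A measurable flow-adapted family of functions on `ℝ^d × ℝ^d`. -/
structure IsFlowAdaptedDensity {Ω : Type*} [MeasurableSpace Ω] (θ : MeasurableFlow d Ω)
    (F : Ω → Sp d → Sp d → ℝ≥0∞) : Prop where
  measurable : Measurable fun p : Ω × Sp d × Sp d => F p.1 p.2.1 p.2.2
  flowAdapted : ∀ s ω x ξ, F (θ s ω) x ξ = F ω (x + s) (ξ + s)

/-- A measurable flow-adapted family of kernels, `T_{θ_s ω}(x, B) = T_ω(x + s, B + s)`. -/
structure IsFlowAdaptedKernel {Ω : Type*} [MeasurableSpace Ω] (θ : MeasurableFlow d Ω)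
    (T : Ω → Sp d → Measure (Sp d)) : Prop where
  measurable : Measurable fun p : Ω × Sp d => T p.1 p.2
  flowAdapted : ∀ s ω x, T (θ s ω) x = shiftMeasure s (T ω (x + s))

end GaleShapley

end

/-! A site that is not exhausted applies to every center in the end, and a center that is not sated
never rejects anyone. So if a single site `x` is not exhausted, then every unsated center `ξ` has
`f_s(x, ξ) = 1`, and the total unused capacity of all centers is at most the mass `1` of `x`.

By stationarity, the expected unused capacity of the centers is a translation invariant measure on
`ℝ^d`. By mass transport and equality of the intensities, it coincides with the expected unused mass
of the sites. By ergodicity, either almost surely all sites are exhausted, or almost surely some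
site is not. In the former case the unused mass of the sites vanishes; in the latter the invariant
measure is finite, hence zero. Either way nothing is left unused. -/

noncomputable section

namespace GaleShapley

open ProbabilityTheory

variable {d : ℕ}

/-! ### S-finiteness of kernels with locally finite values -/

section SFiniteKernel

variable {α β : Type*} [MeasurableSpace α] [MeasurableSpace β] (κ : Kernel α β)

lemma isSFiniteKernel_of_forall_isFiniteMeasure [∀ a, IsFiniteMeasure (κ a)] :
    IsSFiniteKernel κ := by
  classical
  have hm (m : ℕ) : MeasurableSet {a | ⌊(κ a univ).toNNReal⌋₊ = m} :=
    (Nat.measurable_floor.comp (κ.measurable_coe .univ).ennreal_toNNReal) (.singleton m)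
  have hκ : κ = Kernel.sum fun m => Kernel.piecewise (hm m) κ 0 := by
    ext a s hs
    rw [Kernel.sum_apply' _ _ hs, tsum_eq_single ⌊(κ a univ).toNNReal⌋₊]
    · simp [Kernel.piecewise_apply]
    · intro m hne
      simp [Kernel.piecewise_apply, hne.symm]
  have hfin (m : ℕ) : IsFiniteKernel (Kernel.piecewise (hm m) κ 0) := by
    refine ⟨⟨(m + 1 : ℝ≥0), ENNReal.coe_lt_top, fun a => ?_⟩⟩
    rw [Kernel.piecewise_apply]
    split_ifs with ha
    · have hlt := Nat.lt_floor_add_one (κ a univ).toNNReal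
      rw [show ⌊(κ a univ).toNNReal⌋₊ = m from ha] at hlt
      rw [← ENNReal.coe_toNNReal (measure_ne_top (κ a) univ)]
      exact_mod_cast hlt.le
    · simp
  rw [hκ]
  infer_instance

lemma isSFiniteKernel_of_iUnion_eq_univ {s : ℕ → Set β} (hs : ∀ n, MeasurableSet (s n))
    (hU : ⋃ n, s n = univ) (hfin : ∀ a n, κ a (s n) < ∞) : IsSFiniteKernel κ := by
  have hsd (n : ℕ) : MeasurableSet (disjointed s n) := .disjointed hs n
  have hκ : κ = Kernel.sum fun n => κ.restrict (hsd n) := by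
    ext1 a
    simp_rw [Kernel.sum_apply, Kernel.restrict_apply]
    rw [← Measure.restrict_iUnion (disjoint_disjointed s) hsd, iUnion_disjointed, hU,
      Measure.restrict_univ]
  have hsfin (n : ℕ) : IsSFiniteKernel (κ.restrict (hsd n)) := by
    have (a : α) : IsFiniteMeasure (κ.restrict (hsd n) a) := ⟨by
      rw [Kernel.restrict_apply, Measure.restrict_apply_univ]
      exact (measure_mono (disjointed_subset s n)).trans_lt (hfin a n)⟩
    exact isSFiniteKernel_of_forall_isFiniteMeasure _
  rw [hκ]
  infer_instance

instance isSFiniteKernel_of_forall_isLocallyFiniteMeasure [TopologicalSpace β]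
    [OpensMeasurableSpace β] [T2Space β] [SigmaCompactSpace β]
    [∀ a, IsLocallyFiniteMeasure (κ a)] : IsSFiniteKernel κ :=
  isSFiniteKernel_of_iUnion_eq_univ κ (fun n => (isCompact_compactCovering β n).measurableSet)
    (iUnion_compactCovering β) fun _ n => (isCompact_compactCovering β n).measure_lt_top

end SFiniteKernel

/-! ### Joint measurability of the algorithm -/

section Measurability

section Curry

variable {α β γ δ : Type*} [MeasurableSpace α] [MeasurableSpace β] [MeasurableSpace γ]
  [MeasurableSpace δ] {F : α → β → γ → δ}

lemma measurable_uncurry_apply_left (hF : Measurable fun p : α × β × γ => F p.1 p.2.1 p.2.2) :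
    Measurable (Function.uncurry fun (p : α × β) c => F p.1 p.2 c) :=
  hF.comp (by fun_prop : Measurable fun q : (α × β) × γ => (q.1.1, q.1.2, q.2))

lemma measurable_uncurry_apply_right (hF : Measurable fun p : α × β × γ => F p.1 p.2.1 p.2.2) :
    Measurable (Function.uncurry fun (p : α × γ) b => F p.1 b p.2) :=
  hF.comp (by fun_prop : Measurable fun q : (α × γ) × β => (q.1.1, q.2, q.1.2))

end Curry

variable {α β : Type*} [MeasurableSpace α] [MeasurableSpace β]

lemma measurable_setLIntegral_kernel (κ : Kernel α β) [IsSFiniteKernel κ] {w : α → β → ℝ≥0∞}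
    (hw : Measurable (Function.uncurry w)) {s : α → Set β}
    (hs : MeasurableSet {p : α × β | p.2 ∈ s p.1}) :
    Measurable fun a => ∫⁻ b in s a, w a b ∂(κ a) := by
  simp_rw [← lintegral_indicator (show MeasurableSet (s _) from measurable_prodMk_left hs)]
  refine Measurable.lintegral_kernel_prod_right (κ := κ) ?_
  have hind : (Function.uncurry fun a b => (s a).indicator (w a) b)
      = {p : α × β | p.2 ∈ s p.1}.indicator (Function.uncurry w) := by
    ext ⟨a, b⟩; simp [Set.indicator, Function.uncurry]
  rw [hind]
  exact hw.indicator hs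

lemma fillRadius_eq_iSup_rat (μ : Measure (Sp d)) (w : Sp d → ℝ≥0∞) (x : Sp d) :
    fillRadius μ w x =
      ⨆ (q : ℚ) (_ : ∫⁻ y in Metric.closedBall x (Real.toNNReal q : ℝ), w y ∂μ ≤ 1),
        (Real.toNNReal q : ℝ≥0∞) := by
  refine le_antisymm (iSup₂_le fun a ha => le_of_forall_lt fun c hc => ?_)
    (iSup_le fun q => le_iSup_of_le (Real.toNNReal q) le_rfl)
  obtain ⟨q, -, hcq, hqa⟩ := ENNReal.lt_iff_exists_rat_btwn.1 hc
  refine hcq.trans_le (le_iSup₂_of_le q (le_trans (lintegral_mono_set ?_) ha) le_rfl)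
  exact Metric.closedBall_subset_closedBall (by exact_mod_cast hqa.le)

/-- The common form of the constants of the two steps: `boundaryConst 1` is the constant of an
application and `boundaryConst 0` that of a rejection, the first argument being the value taken
where no constant is determined. -/
def boundaryConst (b : ℝ≥0∞) (μ : Measure (Sp d)) (w : Sp d → ℝ≥0∞) (x : Sp d) : ℝ≥0∞ :=
  if fillRadius μ w x = ∞ ∨ sphereMass μ w x = 0 then b
  else 1 - (1 - innerMass μ w x) / sphereMass μ w x

lemma applicationConst_eq_boundaryConst (ψ : Measure (Sp d)) (R : Sp d → Sp d → ℝ≥0∞) (x : Sp d) :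
    applicationConst ψ R x = boundaryConst 1 ψ (fun ξ => 1 - R x ξ) x := rfl

lemma rejectionConst_eq_boundaryConst (φ : Measure (Sp d)) (A : Sp d → Sp d → ℝ≥0∞) (ξ : Sp d) :
    rejectionConst φ A ξ = boundaryConst 0 φ (fun x => A x ξ) ξ := rfl

section FillRadius

variable (κ : Kernel α (Sp d)) [IsSFiniteKernel κ] {w : α → Sp d → ℝ≥0∞} {c : α → Sp d}

lemma measurable_fillRadius (hw : Measurable (Function.uncurry w)) (hc : Measurable c) :
    Measurable fun a => fillRadius (κ a) (w a) (c a) := by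
  simp_rw [fillRadius_eq_iSup_rat, iSup_eq_if]
  refine Measurable.iSup fun q => Measurable.ite (measurableSet_le ?_ measurable_const)
    measurable_const measurable_const
  exact measurable_setLIntegral_kernel κ hw
    (measurableSet_le (measurable_snd.dist (hc.comp measurable_fst)) measurable_const)

lemma measurable_innerMass (hw : Measurable (Function.uncurry w)) (hc : Measurable c) :
    Measurable fun a => innerMass (κ a) (w a) (c a) :=
  measurable_setLIntegral_kernel κ hw
    (measurableSet_lt (measurable_snd.edist (hc.comp measurable_fst))
      ((measurable_fillRadius κ hw hc).comp measurable_fst))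

lemma measurable_sphereMass (hw : Measurable (Function.uncurry w)) (hc : Measurable c) :
    Measurable fun a => sphereMass (κ a) (w a) (c a) :=
  measurable_setLIntegral_kernel κ hw
    (measurableSet_eq_fun (measurable_snd.edist (hc.comp measurable_fst))
      ((measurable_fillRadius κ hw hc).comp measurable_fst))

lemma measurable_boundaryConst (b : ℝ≥0∞) (hw : Measurable (Function.uncurry w))
    (hc : Measurable c) : Measurable fun a => boundaryConst b (κ a) (w a) (c a) := by
  have hs := measurable_sphereMass κ hw hc
  have hi := measurable_innerMass κ hw hc
  exact Measurable.ite
    ((measurable_fillRadius κ hw hc (.singleton ∞)).union (hs (.singleton 0)))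
    measurable_const (measurable_const.sub ((measurable_const.sub hi).div hs))

end FillRadius

section Step

variable (κ : Kernel α (Sp d)) [IsSFiniteKernel κ] {R : α → Sp d → Sp d → ℝ≥0∞}

lemma measurable_applicationRadius (hR : Measurable fun p : α × Sp d × Sp d => R p.1 p.2.1 p.2.2) :
    Measurable fun p : α × Sp d => applicationRadius (κ p.1) (R p.1) p.2 :=
  measurable_fillRadius (κ.prodMkRight (Sp d)) (w := fun p ξ => 1 - R p.1 p.2 ξ)
    (measurable_const.sub (measurable_uncurry_apply_left hR)) measurable_snd

lemma measurable_applicationConst (hR : Measurable fun p : α × Sp d × Sp d => R p.1 p.2.1 p.2.2) :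
    Measurable fun p : α × Sp d => applicationConst (κ p.1) (R p.1) p.2 :=
  measurable_boundaryConst (κ.prodMkRight (Sp d)) 1 (w := fun p ξ => 1 - R p.1 p.2 ξ)
    (measurable_const.sub (measurable_uncurry_apply_left hR)) measurable_snd

lemma measurable_applicationStep (hR : Measurable fun p : α × Sp d × Sp d => R p.1 p.2.1 p.2.2) :
    Measurable fun p : α × Sp d × Sp d => applicationStep (κ p.1) (R p.1) p.2.1 p.2.2 := by
  have hπ : Measurable fun p : α × Sp d × Sp d => (p.1, p.2.1) := by fun_prop
  have hr := (measurable_applicationRadius κ hR).comp hπ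
  have hc := (measurable_applicationConst κ hR).comp hπ
  have he : Measurable fun p : α × Sp d × Sp d => edist p.2.2 p.2.1 := by fun_prop
  exact Measurable.ite (measurableSet_lt he hr) measurable_const
    (Measurable.ite (measurableSet_eq_fun he hr)
      ((hc.mul hR).add (measurable_const.sub hc)) measurable_const)

lemma measurable_rejectionRadius (hR : Measurable fun p : α × Sp d × Sp d => R p.1 p.2.1 p.2.2) :
    Measurable fun p : α × Sp d => rejectionRadius (κ p.1) (R p.1) p.2 :=
  measurable_fillRadius (κ.prodMkRight (Sp d)) (w := fun p x => R p.1 x p.2)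
    (measurable_uncurry_apply_right hR) measurable_snd

lemma measurable_rejectionConst (hR : Measurable fun p : α × Sp d × Sp d => R p.1 p.2.1 p.2.2) :
    Measurable fun p : α × Sp d => rejectionConst (κ p.1) (R p.1) p.2 :=
  measurable_boundaryConst (κ.prodMkRight (Sp d)) 0 (w := fun p x => R p.1 x p.2)
    (measurable_uncurry_apply_right hR) measurable_snd

lemma measurable_rejectionStep (hR : Measurable fun p : α × Sp d × Sp d => R p.1 p.2.1 p.2.2) :
    Measurable fun p : α × Sp d × Sp d => rejectionStep (κ p.1) (R p.1) p.2.1 p.2.2 := by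
  have hπ : Measurable fun p : α × Sp d × Sp d => (p.1, p.2.2) := by fun_prop
  have hr := (measurable_rejectionRadius κ hR).comp hπ
  have hc := (measurable_rejectionConst κ hR).comp hπ
  have he : Measurable fun p : α × Sp d × Sp d => edist p.2.1 p.2.2 := by fun_prop
  exact Measurable.ite (measurableSet_lt he hr) measurable_const
    (Measurable.ite (measurableSet_eq_fun he hr) (hc.mul hR) hR)

end Step

variable (κ η : Kernel α (Sp d)) [IsSFiniteKernel κ] [IsSFiniteKernel η]

lemma measurable_rejectionFn_kernel (n : ℕ) :
    Measurable fun p : α × Sp d × Sp d => rejectionFn (κ p.1) (η p.1) n p.2.1 p.2.2 := by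
  induction n with
  | zero => exact measurable_const
  | succ n ih =>
    exact measurable_rejectionStep κ
      (R := fun a => applicationStep (η a) (rejectionFn (κ a) (η a) n))
      (measurable_applicationStep η (R := fun a => rejectionFn (κ a) (η a) n) ih)

lemma measurable_applicationFn_kernel (n : ℕ) :
    Measurable fun p : α × Sp d × Sp d => applicationFn (κ p.1) (η p.1) n p.2.1 p.2.2 :=
  measurable_applicationStep η (R := fun a => rejectionFn (κ a) (η a) n)
    (measurable_rejectionFn_kernel κ η n)

lemma measurable_rejectionFn (φ ψ : Measure (Sp d)) [SFinite φ] [SFinite ψ] (n : ℕ) :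
    Measurable (Function.uncurry (rejectionFn φ ψ n)) := by
  have h := measurable_rejectionFn_kernel (Kernel.const Unit φ) (Kernel.const Unit ψ) n
  simp only [Kernel.const_apply] at h
  simpa only [Function.comp_def, Function.uncurry_def] using
    h.comp (measurable_prodMk_left (x := ()))

lemma measurable_applicationFn (φ ψ : Measure (Sp d)) [SFinite φ] [SFinite ψ] (n : ℕ) :
    Measurable (Function.uncurry (applicationFn φ ψ n)) := by
  have h := measurable_applicationFn_kernel (Kernel.const Unit φ) (Kernel.const Unit ψ) n
  simp only [Kernel.const_apply] at h
  simpa only [Function.comp_def, Function.uncurry_def] using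
    h.comp (measurable_prodMk_left (x := ()))

end Measurability

/-! ### Equivariance under shifts -/

section Shift

variable (s : Sp d)

lemma lintegral_shiftMeasure (μ : Measure (Sp d)) (g : Sp d → ℝ≥0∞) :
    ∫⁻ y, g y ∂(shiftMeasure s μ) = ∫⁻ y, g (y - s) ∂μ :=
  (measurableEmbedding_subRight s).lintegral_map g

lemma setLIntegral_shiftMeasure (μ : Measure (Sp d)) (g : Sp d → ℝ≥0∞) (B : Set (Sp d)) :
    ∫⁻ y in B, g y ∂(shiftMeasure s μ) = ∫⁻ y in {y | y - s ∈ B}, g (y - s) ∂μ := by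
  rw [shiftMeasure, (measurableEmbedding_subRight s).restrict_map,
    (measurableEmbedding_subRight s).lintegral_map]
  rfl

lemma edist_sub_right_eq (y x : Sp d) : edist (y - s) x = edist y (x + s) := by
  rw [← edist_add_right (y - s) x s, sub_add_cancel]

lemma fillRadius_shiftMeasure (μ : Measure (Sp d)) (w : Sp d → ℝ≥0∞) (x : Sp d) :
    fillRadius (shiftMeasure s μ) (fun y => w (y + s)) x = fillRadius μ w (x + s) := by
  simp only [fillRadius, setLIntegral_shiftMeasure, sub_add_cancel, ← Metric.closedEBall_coe,
    Metric.mem_closedEBall, edist_sub_right_eq]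
  rfl

lemma innerMass_shiftMeasure (μ : Measure (Sp d)) (w : Sp d → ℝ≥0∞) (x : Sp d) :
    innerMass (shiftMeasure s μ) (fun y => w (y + s)) x = innerMass μ w (x + s) := by
  simp only [innerMass, fillRadius_shiftMeasure, setLIntegral_shiftMeasure, sub_add_cancel,
    mem_ofPred_eq, edist_sub_right_eq]

lemma sphereMass_shiftMeasure (μ : Measure (Sp d)) (w : Sp d → ℝ≥0∞) (x : Sp d) :
    sphereMass (shiftMeasure s μ) (fun y => w (y + s)) x = sphereMass μ w (x + s) := by
  simp only [sphereMass, fillRadius_shiftMeasure, setLIntegral_shiftMeasure, sub_add_cancel,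
    mem_ofPred_eq, edist_sub_right_eq]

lemma boundaryConst_shiftMeasure (b : ℝ≥0∞) (μ : Measure (Sp d)) (w : Sp d → ℝ≥0∞) (x : Sp d) :
    boundaryConst b (shiftMeasure s μ) (fun y => w (y + s)) x = boundaryConst b μ w (x + s) := by
  simp only [boundaryConst, fillRadius_shiftMeasure, innerMass_shiftMeasure,
    sphereMass_shiftMeasure]

lemma applicationStep_shiftMeasure (ψ : Measure (Sp d)) (R : Sp d → Sp d → ℝ≥0∞) (x ξ : Sp d) :
    applicationStep (shiftMeasure s ψ) (fun x ξ => R (x + s) (ξ + s)) x ξ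
      = applicationStep ψ R (x + s) (ξ + s) := by
  have hr := fillRadius_shiftMeasure s ψ (fun ξ => 1 - R (x + s) ξ) x
  have hc := boundaryConst_shiftMeasure s 1 ψ (fun ξ => 1 - R (x + s) ξ) x
  simp only [applicationStep, applicationConst_eq_boundaryConst, applicationRadius, hr, hc,
    edist_add_right]

lemma rejectionStep_shiftMeasure (φ : Measure (Sp d)) (A : Sp d → Sp d → ℝ≥0∞) (x ξ : Sp d) :
    rejectionStep (shiftMeasure s φ) (fun x ξ => A (x + s) (ξ + s)) x ξ
      = rejectionStep φ A (x + s) (ξ + s) := by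
  have hr := fillRadius_shiftMeasure s φ (fun x => A x (ξ + s)) ξ
  have hc := boundaryConst_shiftMeasure s 0 φ (fun x => A x (ξ + s)) ξ
  simp only [rejectionStep, rejectionConst_eq_boundaryConst, rejectionRadius, hr, hc,
    edist_add_right]

lemma rejectionFn_shiftMeasure (φ ψ : Measure (Sp d)) (n : ℕ) :
    rejectionFn (shiftMeasure s φ) (shiftMeasure s ψ) n
      = fun x ξ => rejectionFn φ ψ n (x + s) (ξ + s) := by
  induction n with
  | zero => rfl
  | succ n ih =>
    ext x ξ
    rw [rejectionFn, ih, rejectionFn, ← rejectionStep_shiftMeasure]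
    simp_rw [← applicationStep_shiftMeasure]

lemma applicationFn_shiftMeasure (φ ψ : Measure (Sp d)) (n : ℕ) (x ξ : Sp d) :
    applicationFn (shiftMeasure s φ) (shiftMeasure s ψ) n x ξ
      = applicationFn φ ψ n (x + s) (ξ + s) := by
  rw [applicationFn, applicationFn, rejectionFn_shiftMeasure, applicationStep_shiftMeasure]

lemma siteOptimalDensity_shiftMeasure (φ ψ : Measure (Sp d)) (x ξ : Sp d) :
    siteOptimalDensity (shiftMeasure s φ) (shiftMeasure s ψ) x ξ
      = siteOptimalDensity φ ψ (x + s) (ξ + s) := by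
  simp only [siteOptimalDensity, finalApplication, finalRejection, applicationFn_shiftMeasure,
    rejectionFn_shiftMeasure]

lemma densityKernel_shiftMeasure (ψ : Measure (Sp d)) (f : Sp d → Sp d → ℝ≥0∞) (x : Sp d) :
    densityKernel (shiftMeasure s ψ) (fun x ξ => f (x + s) (ξ + s)) x
      = shiftMeasure s (densityKernel ψ f (x + s)) := by
  ext B hB
  have hm : Measurable fun y : Sp d => y - s := measurable_sub_const s
  rw [densityKernel, withDensity_apply _ hB, setLIntegral_shiftMeasure, shiftMeasure,
    Measure.map_apply hm hB, densityKernel, withDensity_apply _ (hm hB)]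
  simp only [sub_add_cancel]
  rfl

end Shift

/-! ### Limits of integrals -/

section Limit

variable {α ι : Type*} [MeasurableSpace α] {μ : Measure α} {l : Filter ι} [l.NeBot]
  [l.IsCountablyGenerated] {g : ι → α → ℝ≥0∞} {f : α → ℝ≥0∞} {C : ℝ≥0∞}

lemma lintegral_le_of_tendsto (hg : ∀ i, Measurable (g i))
    (hlim : ∀ a, Tendsto (fun i => g i a) l (𝓝 (f a))) (hC : ∀ i, ∫⁻ a, g i a ∂μ ≤ C) :
    ∫⁻ a, f a ∂μ ≤ C :=
  calc ∫⁻ a, f a ∂μ = ∫⁻ a, liminf (fun i => g i a) l ∂μ :=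
        lintegral_congr fun a => (hlim a).liminf_eq.symm
    _ ≤ liminf (fun i => ∫⁻ a, g i a ∂μ) l := lintegral_liminf_le hg
    _ ≤ C := liminf_le_of_frequently_le' (Frequently.of_forall hC)

lemma lintegral_eq_of_tendsto_of_le_indicator (hg : ∀ i, Measurable (g i)) {s : Set α}
    (hs : MeasurableSet s) (hμs : μ s ≠ ∞) (hgs : ∀ᶠ i in l, g i ≤ s.indicator 1)
    (hlim : ∀ a, Tendsto (fun i => g i a) l (𝓝 (f a))) (hC : ∀ᶠ i in l, ∫⁻ a, g i a ∂μ = C) :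
    ∫⁻ a, f a ∂μ = C := by
  have hbound : ∫⁻ a, s.indicator 1 a ∂μ ≠ ∞ := by rwa [lintegral_indicator_one hs]
  have hint := tendsto_lintegral_filter_of_dominated_convergence (μ := μ) _ (.of_forall hg)
    (hgs.mono fun i hi => .of_forall hi) hbound (.of_forall hlim)
  exact tendsto_nhds_unique_of_eventuallyEq hint tendsto_const_nhds hC

end Limit

/-! ### The site-optimal density of two locally finite measures -/

section Step

variable {μ : Measure (Sp d)} {R : Sp d → Sp d → ℝ≥0∞} {x ξ : Sp d}

lemma applicationStep_eq_one_of_lt (h : edist ξ x < applicationRadius μ R x) :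
    applicationStep μ R x ξ = 1 :=
  if_pos h

lemma rejectionStep_eq_zero_of_lt (h : edist x ξ < rejectionRadius μ R ξ) :
    rejectionStep μ R x ξ = 0 :=
  if_pos h

lemma applicationStep_le_indicator (hR : ∀ x ξ, R x ξ ≤ 1) {b : ℝ≥0∞}
    (hb : applicationRadius μ R x ≤ b) :
    applicationStep μ R x ≤ (Metric.closedEBall x b).indicator 1 := by
  intro ξ
  by_cases hξ : edist ξ x ≤ b
  · rw [indicator_of_mem (Metric.mem_closedEBall.2 hξ)]
    exact applicationStep_le_one μ R hR x ξ
  · have hlt := hb.trans_lt (not_le.1 hξ)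
    rw [applicationStep, if_neg hlt.not_gt, if_neg hlt.ne']
    exact zero_le

lemma sub_rejectionStep_le_indicator (hR : ∀ x ξ, R x ξ ≤ 1) {b : ℝ≥0∞}
    (hb : rejectionRadius μ R ξ ≤ b) :
    (fun x => R x ξ - rejectionStep μ R x ξ) ≤ (Metric.closedEBall ξ b).indicator 1 := by
  intro x
  by_cases hx : edist x ξ ≤ b
  · rw [indicator_of_mem (Metric.mem_closedEBall.2 hx)]
    exact tsub_le_self.trans (hR x ξ)
  · have hlt := hb.trans_lt (not_le.1 hx)
    simp only [rejectionStep, if_neg hlt.not_gt, if_neg hlt.ne', tsub_self, zero_le]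

lemma innerMass_of_fillRadius_eq_top {w : Sp d → ℝ≥0∞} (h : fillRadius μ w x = ∞) :
    innerMass μ w x = ∫⁻ y, w y ∂μ := by
  simp only [innerMass, h, edist_lt_top, ofPred_true, Measure.restrict_univ]

variable [IsLocallyFiniteMeasure μ]

lemma measure_closedEBall_ne_top (x : Sp d) {b : ℝ≥0∞} (hb : b ≠ ∞) :
    μ (Metric.closedEBall x b) ≠ ∞ := by
  lift b to ℝ≥0 using hb
  rw [Metric.closedEBall_coe]
  exact measure_closedBall_lt_top.ne

lemma lintegral_applicationStep_sub_le (hR : ∀ x ξ, R x ξ ≤ 1) (x : Sp d) :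
    ∫⁻ ξ, (applicationStep μ R x ξ - R x ξ) ∂μ ≤ 1 := by
  by_cases hr : applicationRadius μ R x = ∞
  · simp_rw [applicationStep_eq_one_of_lt (hr ▸ edist_lt_top _ _),
      ← innerMass_of_fillRadius_eq_top hr]
    exact innerMass_le_one _ _ _
  · exact (lintegral_applicationStep μ R hR x hr).le

lemma lintegral_sub_rejectionStep_le (hR : ∀ x ξ, R x ξ ≤ 1) (ξ : Sp d) :
    ∫⁻ x, (R x ξ - rejectionStep μ R x ξ) ∂μ ≤ 1 := by
  by_cases hr : rejectionRadius μ R ξ = ∞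
  · simp_rw [rejectionStep_eq_zero_of_lt (hr ▸ edist_lt_top _ _), tsub_zero,
      ← innerMass_of_fillRadius_eq_top hr]
    exact innerMass_le_one _ _ _
  · exact (lintegral_rejectionStep μ R hR ξ hr).le

end Step

section SiteOptimalDensity

lemma applicationFn_le_one (φ ψ : Measure (Sp d)) (n : ℕ) (x ξ : Sp d) :
    applicationFn φ ψ n x ξ ≤ 1 :=
  applicationStep_le_one ψ _ (rejectionFn_le_one φ ψ n) x ξ

variable (φ ψ : Measure (Sp d)) [IsLocallyFiniteMeasure ψ]

lemma finalApplication_le_one (x ξ : Sp d) : finalApplication φ ψ x ξ ≤ 1 :=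
  le_of_tendsto' (tendsto_finalApplication φ ψ x ξ) fun n => applicationFn_le_one φ ψ n x ξ

lemma siteOptimalDensity_le_one (x ξ : Sp d) : siteOptimalDensity φ ψ x ξ ≤ 1 :=
  tsub_le_self.trans (finalApplication_le_one φ ψ x ξ)

lemma tendsto_applicationFn_sub_rejectionFn (x ξ : Sp d) :
    Tendsto (fun n => applicationFn φ ψ n x ξ - rejectionFn φ ψ n x ξ) atTop
      (𝓝 (siteOptimalDensity φ ψ x ξ)) :=
  ENNReal.Tendsto.sub (tendsto_finalApplication φ ψ x ξ) (tendsto_finalRejection φ ψ x ξ)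
    (.inl (ne_top_of_le_ne_top ENNReal.one_ne_top (finalApplication_le_one φ ψ x ξ)))

lemma tendsto_applicationFn_sub_rejectionFn_succ (x ξ : Sp d) :
    Tendsto (fun n => applicationFn φ ψ n x ξ - rejectionFn φ ψ (n + 1) x ξ) atTop
      (𝓝 (siteOptimalDensity φ ψ x ξ)) :=
  ENNReal.Tendsto.sub (tendsto_finalApplication φ ψ x ξ)
    ((tendsto_finalRejection φ ψ x ξ).comp (tendsto_add_atTop_nat 1))
    (.inl (ne_top_of_le_ne_top ENNReal.one_ne_top (finalApplication_le_one φ ψ x ξ)))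

lemma measurable_siteOptimalDensity_kernel {α : Type*} [MeasurableSpace α] (κ η : Kernel α (Sp d))
    [IsSFiniteKernel κ] [∀ a, IsLocallyFiniteMeasure (η a)] :
    Measurable fun p : α × Sp d × Sp d => siteOptimalDensity (κ p.1) (η p.1) p.2.1 p.2.2 :=
  measurable_of_tendsto_metrizable
    (fun n => (measurable_applicationFn_kernel κ η n).sub (measurable_rejectionFn_kernel κ η n))
    (tendsto_pi_nhds.2 fun _ => tendsto_applicationFn_sub_rejectionFn _ _ _ _)

section SFinite

variable [SFinite φ]

lemma measurable_siteOptimalDensity : Measurable (Function.uncurry (siteOptimalDensity φ ψ)) :=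
  measurable_of_tendsto_metrizable
    (fun n => (measurable_applicationFn φ ψ n).sub (measurable_rejectionFn φ ψ n))
    (tendsto_pi_nhds.2 fun _ => tendsto_applicationFn_sub_rejectionFn _ _ _ _)

lemma measurable_applicationFn_sub_rejectionFn (m n : ℕ) :
    Measurable (Function.uncurry fun x ξ => applicationFn φ ψ m x ξ - rejectionFn φ ψ n x ξ) :=
  (measurable_applicationFn φ ψ m).sub (measurable_rejectionFn φ ψ n)

lemma lintegral_siteOptimalDensity_site_le (x : Sp d) :
    ∫⁻ ξ, siteOptimalDensity φ ψ x ξ ∂ψ ≤ 1 :=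
  lintegral_le_of_tendsto
    (fun n => (measurable_applicationFn_sub_rejectionFn φ ψ n n).of_uncurry_left)
    (tendsto_applicationFn_sub_rejectionFn φ ψ x)
    (fun n => lintegral_applicationStep_sub_le (rejectionFn_le_one φ ψ n) x)

lemma iSup_applicationRadius_eq_top {x : Sp d} (hx : ∫⁻ ξ, siteOptimalDensity φ ψ x ξ ∂ψ ≠ 1) :
    ⨆ n, applicationRadius ψ (rejectionFn φ ψ n) x = ∞ := by
  by_contra hfin
  have hle (n : ℕ) := le_iSup (fun n => applicationRadius ψ (rejectionFn φ ψ n) x) n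
  refine hx (lintegral_eq_of_tendsto_of_le_indicator
    (fun n => (measurable_applicationFn_sub_rejectionFn φ ψ n n).of_uncurry_left)
    Metric.isClosed_closedEBall.measurableSet (measure_closedEBall_ne_top x hfin) (.of_forall ?_)
    (tendsto_applicationFn_sub_rejectionFn φ ψ x) (.of_forall ?_))
  · exact fun n ξ => tsub_le_self.trans
      (applicationStep_le_indicator (rejectionFn_le_one φ ψ n) (hle n) ξ)
  · exact fun n => lintegral_applicationStep ψ _ (rejectionFn_le_one φ ψ n) x
      (ne_top_of_le_ne_top hfin (hle n))

lemma finalApplication_eq_one {x : Sp d} (hx : ∫⁻ ξ, siteOptimalDensity φ ψ x ξ ∂ψ ≠ 1)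
    (ξ : Sp d) : finalApplication φ ψ x ξ = 1 := by
  obtain ⟨n, hn⟩ := lt_iSup_iff.1 (iSup_applicationRadius_eq_top φ ψ hx ▸ edist_lt_top ξ x)
  refine (finalApplication_le_one φ ψ x ξ).antisymm ?_
  calc 1 = applicationFn φ ψ n x ξ := (applicationStep_eq_one_of_lt hn).symm
    _ ≤ finalApplication φ ψ x ξ :=
      (applicationFn_monotone φ ψ x ξ).ge_of_tendsto (tendsto_finalApplication φ ψ x ξ) n

end SFinite

variable [IsLocallyFiniteMeasure φ]

lemma lintegral_siteOptimalDensity_center_le (ξ : Sp d) :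
    ∫⁻ x, siteOptimalDensity φ ψ x ξ ∂φ ≤ 1 :=
  lintegral_le_of_tendsto
    (fun n => (measurable_applicationFn_sub_rejectionFn φ ψ n (n + 1)).of_uncurry_right)
    (fun x => tendsto_applicationFn_sub_rejectionFn_succ φ ψ x ξ)
    (fun n => lintegral_sub_rejectionStep_le (applicationFn_le_one φ ψ n) ξ)

lemma isConstrained_siteOptimalDensity : IsConstrained φ ψ (siteOptimalDensity φ ψ) where
  measurable := measurable_siteOptimalDensity φ ψ
  site_le := lintegral_siteOptimalDensity_site_le φ ψ
  center_le := lintegral_siteOptimalDensity_center_le φ ψ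
  le_one := siteOptimalDensity_le_one φ ψ

lemma rejectionRadius_applicationFn_eq_top {ξ : Sp d}
    (hξ : ∫⁻ x, siteOptimalDensity φ ψ x ξ ∂φ ≠ 1) (n : ℕ) :
    rejectionRadius φ (applicationFn φ ψ n) ξ = ∞ := by
  by_contra hfin
  have hle {m : ℕ} (hnm : n ≤ m) :
      rejectionRadius φ (applicationFn φ ψ m) ξ ≤ rejectionRadius φ (applicationFn φ ψ n) ξ :=
    fillRadius_anti φ (fun x => applicationFn_monotone φ ψ x ξ hnm) ξ
  refine hξ (lintegral_eq_of_tendsto_of_le_indicator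
    (fun m => (measurable_applicationFn_sub_rejectionFn φ ψ m (m + 1)).of_uncurry_right)
    Metric.isClosed_closedEBall.measurableSet (measure_closedEBall_ne_top ξ hfin) ?_
    (fun x => tendsto_applicationFn_sub_rejectionFn_succ φ ψ x ξ) ?_)
  · filter_upwards [eventually_ge_atTop n] with m hm
    exact sub_rejectionStep_le_indicator (applicationFn_le_one φ ψ m) (hle hm)
  · filter_upwards [eventually_ge_atTop n] with m hm
    exact lintegral_rejectionStep φ _ (applicationFn_le_one φ ψ m) ξ
      (ne_top_of_le_ne_top hfin (hle hm))

lemma finalRejection_eq_zero {ξ : Sp d} (hξ : ∫⁻ x, siteOptimalDensity φ ψ x ξ ∂φ ≠ 1)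
    (x : Sp d) : finalRejection φ ψ x ξ = 0 := by
  have hzero (n : ℕ) : rejectionFn φ ψ n x ξ = 0 := by
    cases n with
    | zero => rfl
    | succ n =>
      exact rejectionStep_eq_zero_of_lt
        (rejectionRadius_applicationFn_eq_top φ ψ hξ n ▸ edist_lt_top x ξ)
  exact tendsto_nhds_unique (tendsto_finalRejection φ ψ x ξ)
    (tendsto_const_nhds.congr fun n => (hzero n).symm)

/- An unexhausted site `x` and an unsated center `ξ` have `f_s(x, ξ) = 1 - 0`, so that the total
unused capacity of the centers is at most what `x` uses. -/
lemma lintegral_center_deficit_le_one {x : Sp d}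
    (hx : ∫⁻ ξ, siteOptimalDensity φ ψ x ξ ∂ψ ≠ 1) :
    ∫⁻ ξ, (1 - ∫⁻ y, siteOptimalDensity φ ψ y ξ ∂φ) ∂ψ ≤ 1 := by
  refine (lintegral_mono fun ξ => ?_).trans (lintegral_siteOptimalDensity_site_le φ ψ x)
  by_cases hξ : ∫⁻ y, siteOptimalDensity φ ψ y ξ ∂φ = 1
  · rw [hξ, tsub_self]
    exact zero_le
  · rw [siteOptimalDensity, finalApplication_eq_one φ ψ hx, finalRejection_eq_zero φ ψ hξ,
      tsub_zero]
    exact tsub_le_self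

end SiteOptimalDensity

lemma IsBalancing.isBalancingTransportKernel_densityKernel {φ ψ : Measure (Sp d)} [SFinite φ]
    [SFinite ψ] {f : Sp d → Sp d → ℝ≥0∞} (hf : IsBalancing φ ψ f) :
    IsBalancingTransportKernel φ ψ (densityKernel ψ f) where
  measurable := by
    refine Measure.measurable_of_measurable_coe _ fun B hB => ?_
    simp_rw [densityKernel, withDensity_apply _ hB]
    exact hf.measurable.lintegral_prod_right'
  locallyFinite x := by
    have := isFiniteMeasure_withDensity ((hf.site_le x).trans_lt ENNReal.one_lt_top).ne
    exact inferInstanceAs (IsLocallyFiniteMeasure (ψ.withDensity (f x)))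
  markov := by
    filter_upwards [hf.site_eq] with x hx
    rw [densityKernel, withDensity_apply _ .univ, Measure.restrict_univ, hx]
  balancing B hB := by
    simp_rw [densityKernel, withDensity_apply _ hB]
    rw [lintegral_lintegral_swap hf.measurable.aemeasurable,
      lintegral_congr_ae (ae_restrict_of_ae hf.center_eq), setLIntegral_one]

/-! ### Mass transport and finite invariant measures -/

section InvariantMeasure

variable {G : Type*} [AddGroup G] [MeasurableSpace G]

section MassTransport

variable [MeasurableAdd₂ G] [MeasurableNeg G] {M : Measure (G × G)} [SFinite M]
  (μ : Measure G) [SFinite μ] [μ.IsAddLeftInvariant] [μ.IsNegInvariant]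

lemma lintegral_fst_mul_lintegral_eq (hM : ∀ s, M.map (Prod.map (· + s) (· + s)) = M)
    {f h : G → ℝ≥0∞} (hf : Measurable f) (hh : Measurable h) :
    (∫⁻ x, f x ∂M.fst) * ∫⁻ x, h x ∂μ = (∫⁻ x, h x ∂M.snd) * ∫⁻ x, f x ∂μ :=
  calc (∫⁻ x, f x ∂M.fst) * ∫⁻ x, h x ∂μ
      = ∫⁻ p, ∫⁻ s, f p.1 * h (p.2 + s) ∂μ ∂M := by
        rw [Measure.fst, lintegral_map hf measurable_fst, ← lintegral_mul_const _ (by fun_prop)]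
        refine lintegral_congr fun p => ?_
        rw [lintegral_const_mul _ (by fun_prop), lintegral_add_left_eq_self]
    _ = ∫⁻ s, ∫⁻ p, f p.1 * h (p.2 + s) ∂M ∂μ := lintegral_lintegral_swap (by fun_prop)
    _ = ∫⁻ s, ∫⁻ p, f (p.1 - s) * h p.2 ∂M ∂μ := by
        refine lintegral_congr fun s => ?_
        conv_rhs => rw [← hM s]
        rw [lintegral_map (by fun_prop) (by fun_prop)]
        simp only [Prod.map_fst, Prod.map_snd, add_sub_cancel_right]
    _ = ∫⁻ p, ∫⁻ s, f (p.1 - s) * h p.2 ∂μ ∂M := lintegral_lintegral_swap (by fun_prop)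
    _ = (∫⁻ x, h x ∂M.snd) * ∫⁻ x, f x ∂μ := by
        rw [Measure.snd, lintegral_map hh measurable_snd, ← lintegral_mul_const _ (by fun_prop)]
        refine lintegral_congr fun p => ?_
        rw [lintegral_mul_const _ (by fun_prop), lintegral_sub_left_eq_self, mul_comm]

lemma fst_eq_snd_of_map_add_eq_self [SigmaFinite μ] [NeZero μ]
    (hM : ∀ s, M.map (Prod.map (· + s) (· + s)) = M) : M.fst = M.snd := by
  obtain ⟨Q, hQ, -, hQ0, hQt⟩ := Measure.exists_subset_measure_lt_top (μ := μ) (r := 0) .univ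
    (Measure.measure_univ_pos.2 (NeZero.ne μ))
  have hcancel {a b : ℝ≥0∞} (hab : a * μ Q = b * μ Q) : a = b :=
    (ENNReal.mul_left_inj hQ0.ne' hQt.ne).1 hab
  have hswap {f h : G → ℝ≥0∞} := lintegral_fst_mul_lintegral_eq μ hM (f := f) (h := h)
  have h1 : Measurable (Q.indicator (1 : G → ℝ≥0∞)) := measurable_one.indicator hQ
  have hQeq : M.fst Q = M.snd Q :=
    hcancel (by simpa only [lintegral_indicator_one hQ] using hswap h1 h1)
  refine Measure.ext_of_lintegral _ fun f hf => hcancel ?_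
  calc (∫⁻ x, f x ∂M.fst) * μ Q = M.snd Q * ∫⁻ x, f x ∂μ := by
        simpa only [lintegral_indicator_one hQ] using hswap hf h1
    _ = M.fst Q * ∫⁻ x, f x ∂μ := by rw [hQeq]
    _ = (∫⁻ x, f x ∂M.snd) * μ Q := by
        simpa only [lintegral_indicator_one hQ] using hswap h1 hf

end MassTransport

lemma eq_zero_of_isAddLeftInvariant [TopologicalSpace G] [IsTopologicalAddGroup G] [BorelSpace G]
    [WeaklyLocallyCompactSpace G] [NoncompactSpace G] (m : Measure G) [m.IsAddLeftInvariant]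
    [m.Regular] [IsFiniteMeasure m] : m = 0 := by
  by_contra hm
  have : NeZero m := ⟨hm⟩
  have : m.IsOpenPosMeasure := isOpenPosMeasure_of_addLeftInvariant_of_regular
  exact measure_ne_top m univ (measure_univ_of_isAddLeftInvariant m)

end InvariantMeasure

/-! ### Weighted intensity measures -/

section WeightedIntensity

variable {Ω α β : Type*} [MeasurableSpace Ω] [MeasurableSpace α] [MeasurableSpace β]

/-- The intensity measure `B ↦ 𝔼 ∫_B g(ω, y) κ_ω(dy)` of the random measure `κ`, weighted
by `g`. -/
def weightedIntensity (P : Measure Ω) (κ : Kernel Ω β) (g : Ω × β → ℝ≥0∞) : Measure β :=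
  ((P ⊗ₘ κ).withDensity g).map Prod.snd

/-- The mass `∫ F(ω, x, ξ) η_ω(dξ)` that `x` sends out under the random density `F`. The mass that
`ξ` receives is its `outflow` under the density with arguments swapped. -/
def outflow (η : Kernel Ω β) (F : Ω → α → β → ℝ≥0∞) (p : Ω × α) : ℝ≥0∞ :=
  ∫⁻ ξ, F p.1 p.2 ξ ∂(η p.1)

instance (P : Measure Ω) (κ : Kernel Ω β) (g : Ω × β → ℝ≥0∞) :
    SFinite (weightedIntensity P κ g) := by
  unfold weightedIntensity; infer_instance

variable (P : Measure Ω) (κ : Kernel Ω α) (η : Kernel Ω β)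

section Linear

variable {g : Ω × β → ℝ≥0∞}

lemma weightedIntensity_add (hg : Measurable g) (g' : Ω × β → ℝ≥0∞) :
    weightedIntensity P η (g + g') = weightedIntensity P η g + weightedIntensity P η g' := by
  rw [weightedIntensity, withDensity_add_left hg, Measure.map_add _ _ measurable_snd]
  rfl

lemma weightedIntensity_sub_add_self {g' : Ω × β → ℝ≥0∞} (hg : Measurable g) (hg' : Measurable g')
    (hle : g ≤ g') :
    weightedIntensity P η (g' - g) + weightedIntensity P η g = weightedIntensity P η g' := by
  rw [← weightedIntensity_add P η (hg'.sub hg), tsub_add_cancel_of_le hle]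

variable [SFinite P] [IsSFiniteKernel η]

lemma weightedIntensity_eq_zero_iff (hg : Measurable g) :
    weightedIntensity P η g = 0 ↔ ∀ᵐ ω ∂P, ∀ᵐ y ∂(η ω), g (ω, y) = 0 := by
  rw [weightedIntensity, Measure.map_eq_zero_iff measurable_snd.aemeasurable,
    withDensity_eq_zero_iff hg.aemeasurable]
  exact Measure.ae_compProd_iff (hg (measurableSet_singleton 0))

lemma lintegral_weightedIntensity (hg : Measurable g) {h : β → ℝ≥0∞} (hh : Measurable h) :
    ∫⁻ y, h y ∂(weightedIntensity P η g) = ∫⁻ ω, ∫⁻ y, g (ω, y) * h y ∂(η ω) ∂P := by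
  have hh' : Measurable fun p : Ω × β => h p.2 := hh.comp measurable_snd
  rw [weightedIntensity, lintegral_map hh measurable_snd,
    lintegral_withDensity_eq_lintegral_mul _ hg hh', Measure.lintegral_compProd (hg.mul hh')]
  rfl

lemma weightedIntensity_apply (hg : Measurable g) {B : Set β} (hB : MeasurableSet B) :
    weightedIntensity P η g B = ∫⁻ ω, ∫⁻ y in B, g (ω, y) ∂(η ω) ∂P := by
  rw [← lintegral_indicator_one hB,
    lintegral_weightedIntensity P η hg (measurable_one.indicator hB)]
  refine lintegral_congr fun ω => ?_
  rw [← lintegral_indicator hB]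
  refine lintegral_congr fun y => ?_
  by_cases hy : y ∈ B <;> simp [hy]

lemma map_weightedIntensity_eq_self (hg : Measurable g) {T : Ω → Ω} (hT : MeasurePreserving T P P)
    {τ : β → β} (hτ : Measurable τ) (hη : ∀ ω, η ω = (η (T ω)).map τ)
    (hgT : ∀ ω y, g (T ω, y) = g (ω, τ y)) :
    (weightedIntensity P η g).map τ = weightedIntensity P η g := by
  refine Measure.ext_of_lintegral _ fun h hh => ?_
  have hmeas : Measurable fun ω => ∫⁻ y, g (ω, y) * h (τ y) ∂(η ω) :=
    Measurable.lintegral_kernel_prod_right (κ := η) (hg.mul ((hh.comp hτ).comp measurable_snd))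
  calc ∫⁻ y, h y ∂(weightedIntensity P η g).map τ
      = ∫⁻ ω, ∫⁻ y, g (ω, y) * h (τ y) ∂(η ω) ∂P := by
        rw [lintegral_map hh hτ,
          lintegral_weightedIntensity P η hg (h := fun y => h (τ y)) (hh.comp hτ)]
    _ = ∫⁻ ω, ∫⁻ y, g (ω, τ y) * h (τ y) ∂(η (T ω)) ∂P := by
        simp_rw [← hT.lintegral_comp hmeas, hgT]
    _ = ∫⁻ ω, ∫⁻ y, g (ω, y) * h y ∂(η ω) ∂P := by
        refine lintegral_congr fun ω => ?_
        have hmeasω : Measurable fun y => g (ω, y) * h y := (hg.comp measurable_prodMk_left).mul hh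
        rw [hη ω, lintegral_map hmeasω hτ]
    _ = ∫⁻ y, h y ∂(weightedIntensity P η g) := (lintegral_weightedIntensity P η hg hh).symm

end Linear

variable [IsSFiniteKernel η] {F : Ω → α → β → ℝ≥0∞}

lemma measurable_outflow (hF : Measurable fun p : Ω × α × β => F p.1 p.2.1 p.2.2) :
    Measurable (outflow η F) :=
  Measurable.lintegral_kernel_prod_right (κ := Kernel.prodMkRight α η)
    (measurable_uncurry_apply_left hF)

variable [SFinite P] [IsSFiniteKernel κ]

lemma fst_weightedIntensity_prod
    (hF : Measurable fun p : Ω × α × β => F p.1 p.2.1 p.2.2) :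
    (weightedIntensity P (κ ×ₖ η) fun p => F p.1 p.2.1 p.2.2).fst
      = weightedIntensity P κ (outflow η F) := by
  refine Measure.ext_of_lintegral _ fun h hh => ?_
  rw [Measure.fst, lintegral_map hh measurable_fst,
    lintegral_weightedIntensity P _ hF (h := fun p => h p.1) (hh.comp measurable_fst),
    lintegral_weightedIntensity P κ (measurable_outflow η hF) hh]
  refine lintegral_congr fun ω => ?_
  have hFω : Measurable (Function.uncurry (F ω)) := hF.comp measurable_prodMk_left
  calc ∫⁻ p, F ω p.1 p.2 * h p.1 ∂((κ ×ₖ η) ω) = ∫⁻ x, ∫⁻ ξ, F ω x ξ * h x ∂(η ω) ∂(κ ω) := by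
        rw [Kernel.prod_apply]
        exact lintegral_prod _ (hFω.mul (hh.comp measurable_fst)).aemeasurable
    _ = ∫⁻ x, outflow η F (ω, x) * h x ∂(κ ω) :=
        lintegral_congr fun x => lintegral_mul_const _ hFω.of_uncurry_left

lemma snd_weightedIntensity_prod
    (hF : Measurable fun p : Ω × α × β => F p.1 p.2.1 p.2.2) :
    (weightedIntensity P (κ ×ₖ η) fun p => F p.1 p.2.1 p.2.2).snd
      = weightedIntensity P η (outflow κ fun ω => Function.swap (F ω)) := by
  have hF' : Measurable fun p : Ω × β × α => Function.swap (F p.1) p.2.1 p.2.2 :=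
    hF.comp (by fun_prop : Measurable fun q : Ω × β × α => (q.1, q.2.2, q.2.1))
  refine Measure.ext_of_lintegral _ fun h hh => ?_
  rw [Measure.snd, lintegral_map hh measurable_snd,
    lintegral_weightedIntensity P _ hF (h := fun p => h p.2) (hh.comp measurable_snd),
    lintegral_weightedIntensity P η (measurable_outflow κ hF') hh]
  refine lintegral_congr fun ω => ?_
  have hFω : Measurable (Function.uncurry (F ω)) := hF.comp measurable_prodMk_left
  calc ∫⁻ p, F ω p.1 p.2 * h p.2 ∂((κ ×ₖ η) ω) = ∫⁻ ξ, ∫⁻ x, F ω x ξ * h ξ ∂(κ ω) ∂(η ω) := by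
        rw [Kernel.prod_apply]
        exact lintegral_prod_symm _ (hFω.mul (hh.comp measurable_snd)).aemeasurable
    _ = ∫⁻ ξ, outflow κ (fun ω => Function.swap (F ω)) (ω, ξ) * h ξ ∂(η ω) :=
        lintegral_congr fun ξ => lintegral_mul_const _ hFω.of_uncurry_right

end WeightedIntensity

section HasIntensity

variable {Ω : Type*} [MeasurableSpace Ω] {P : Measure Ω} [SFinite P] {κ : Kernel Ω (Sp d)}
  [IsSFiniteKernel κ] {lam : ℝ≥0∞}

lemma weightedIntensity_one_eq_smul_volume (hκlam : HasIntensity P κ lam) :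
    weightedIntensity P κ 1 = lam • volume := by
  ext B hB
  simp only [weightedIntensity_apply P κ measurable_one hB, Pi.one_apply, setLIntegral_one,
    hκlam B hB, Measure.smul_apply, smul_eq_mul]

lemma sigmaFinite_weightedIntensity_one (hlam : lam ≠ ∞) (hκlam : HasIntensity P κ lam) :
    SigmaFinite (weightedIntensity P κ 1) := by
  lift lam to ℝ≥0 using hlam
  rw [weightedIntensity_one_eq_smul_volume hκlam]
  exact inferInstanceAs (SigmaFinite (lam • volume))

end HasIntensity

/-! ### Flow-adapted random measures -/

section FlowAdapted

variable {Ω : Type*} [MeasurableSpace Ω] {θ : MeasurableFlow d Ω} {P : Measure Ω}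
  {κ η : Kernel Ω (Sp d)} {F : Ω → Sp d → Sp d → ℝ≥0∞}

lemma map_add_shiftMeasure (s : Sp d) (μ : Measure (Sp d)) :
    (shiftMeasure s μ).map (· + s) = μ := by
  rw [shiftMeasure, Measure.map_map (by fun_prop) (by fun_prop)]
  simp only [Function.comp_def, sub_add_cancel, Measure.map_id']

lemma IsFlowAdaptedDensity.swap (hF : IsFlowAdaptedDensity θ F) :
    IsFlowAdaptedDensity θ fun ω => Function.swap (F ω) where
  measurable := hF.measurable.comp (by fun_prop :
    Measurable fun q : Ω × Sp d × Sp d => (q.1, q.2.2, q.2.1))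
  flowAdapted s ω ξ x := hF.flowAdapted s ω x ξ

lemma isFlowAdaptedDensity_siteOptimalDensity [IsSFiniteKernel κ]
    [∀ ω, IsLocallyFiniteMeasure (η ω)] (hκ : ∀ s ω, κ (θ s ω) = shiftMeasure s (κ ω))
    (hη : ∀ s ω, η (θ s ω) = shiftMeasure s (η ω)) :
    IsFlowAdaptedDensity θ fun ω => siteOptimalDensity (κ ω) (η ω) where
  measurable := measurable_siteOptimalDensity_kernel κ η
  flowAdapted s ω x ξ := by rw [hκ, hη, siteOptimalDensity_shiftMeasure]

lemma isFlowAdaptedKernel_densityKernel [IsSFiniteKernel η]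
    (hη : ∀ s ω, η (θ s ω) = shiftMeasure s (η ω)) (hF : IsFlowAdaptedDensity θ F) :
    IsFlowAdaptedKernel θ fun ω => densityKernel (η ω) (F ω) where
  measurable := by
    refine Measure.measurable_of_measurable_coe _ fun B hB => ?_
    simp_rw [densityKernel, withDensity_apply _ hB]
    exact Measurable.setLIntegral_kernel_prod_right (κ := Kernel.prodMkRight (Sp d) η)
      (measurable_uncurry_apply_left hF.measurable) hB
  flowAdapted s ω x := by
    rw [hη, ← densityKernel_shiftMeasure]
    exact congrArg (Measure.withDensity _) (funext (hF.flowAdapted s ω x))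

lemma IsFlowAdaptedDensity.one_sub_outflow_flow (hF : IsFlowAdaptedDensity θ F)
    (hη : ∀ s ω, η (θ s ω) = shiftMeasure s (η ω)) (s : Sp d) (ω : Ω) (x : Sp d) :
    (1 - outflow η F) (θ s ω, x) = (1 - outflow η F) (ω, x + s) := by
  simp only [Pi.sub_apply, outflow, hη, lintegral_shiftMeasure, hF.flowAdapted, sub_add_cancel]
  rfl

section Invariance

variable [IsSFiniteKernel κ] {g : Ω × Sp d → ℝ≥0∞}

lemma map_add_weightedIntensity_eq_self [SFinite P] (hP : ∀ s, MeasurePreserving (θ s) P P)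
    (hκ : ∀ s ω, κ (θ s ω) = shiftMeasure s (κ ω)) (hg : Measurable g)
    (hgθ : ∀ s ω y, g (θ s ω, y) = g (ω, y + s)) (s : Sp d) :
    (weightedIntensity P κ g).map (· + s) = weightedIntensity P κ g :=
  map_weightedIntensity_eq_self P κ hg (hP s) (measurable_add_const s)
    (fun ω => by rw [hκ, map_add_shiftMeasure]) (hgθ s)

variable [IsProbabilityMeasure P]

lemma weightedIntensity_eq_zero_of_ae_lintegral_le (hd : 0 < d)
    (hP : ∀ s, MeasurePreserving (θ s) P P) (hκ : ∀ s ω, κ (θ s ω) = shiftMeasure s (κ ω))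
    (hg : Measurable g) (hgθ : ∀ s ω y, g (θ s ω, y) = g (ω, y + s)) {C : ℝ≥0∞} (hC : C ≠ ∞)
    (hle : ∀ᵐ ω ∂P, ∫⁻ y, g (ω, y) ∂(κ ω) ≤ C) : weightedIntensity P κ g = 0 := by
  have : Nonempty (Fin d) := ⟨⟨0, hd⟩⟩
  have : NoncompactSpace (Sp d) := NormedSpace.noncompactSpace ℝ (Sp d)
  have : IsFiniteMeasure (weightedIntensity P κ g) := ⟨by
    rw [weightedIntensity_apply P κ hg .univ]
    simp_rw [Measure.restrict_univ]
    exact (lintegral_le_const hle).trans_lt hC.lt_top⟩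
  have : (weightedIntensity P κ g).IsAddLeftInvariant := ⟨fun s => by
    simpa only [add_comm s] using map_add_weightedIntensity_eq_self hP hκ hg hgθ s⟩
  exact eq_zero_of_isAddLeftInvariant _

lemma weightedIntensity_eq_zero_or_ae_exists_ne_zero
    (herg : ∀ S : Set Ω, MeasurableSet S → (∀ s, θ s ⁻¹' S = S) → P S = 0 ∨ P S = 1)
    (hκ : ∀ s ω, κ (θ s ω) = shiftMeasure s (κ ω)) (hg : Measurable g)
    (hgθ : ∀ s ω y, g (θ s ω, y) = g (ω, y + s)) :
    weightedIntensity P κ g = 0 ∨ ∀ᵐ ω ∂P, ∃ y, g (ω, y) ≠ 0 := by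
  set S : Set Ω := {ω | ∫⁻ y, g (ω, y) ∂(κ ω) ≠ 0} with hS
  have hSm : MeasurableSet S :=
    (Measurable.lintegral_kernel_prod_right (κ := κ) (f := fun ω y => g (ω, y)) hg)
      (measurableSet_singleton 0).compl
  have hSinv (s : Sp d) : θ s ⁻¹' S = S := by
    simp only [hS, preimage_ofPred_eq, hκ, lintegral_shiftMeasure, hgθ, sub_add_cancel]
  rcases herg S hSm hSinv with h0 | h1
  · left
    rw [weightedIntensity_eq_zero_iff P κ hg]
    filter_upwards [measure_eq_zero_iff_ae_notMem.1 h0] with ω hω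
    exact (lintegral_eq_zero_iff (hg.comp measurable_prodMk_left)).1 (not_not.1 hω)
  · right
    filter_upwards [(mem_ae_iff_prob_eq_one hSm).2 h1] with ω hω
    by_contra! hzero
    exact hω (by simp only [hzero, lintegral_zero])

end Invariance

section Deficit

variable [SFinite P] [IsSFiniteKernel κ]

lemma ae_ae_eq_one_of_weightedIntensity_one_sub_eq_zero {g : Ω × Sp d → ℝ≥0∞}
    (hg : Measurable g) (hle : g ≤ 1) (h0 : weightedIntensity P κ (1 - g) = 0) :
    ∀ᵐ ω ∂P, ∀ᵐ x ∂(κ ω), g (ω, x) = 1 := by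
  filter_upwards [(weightedIntensity_eq_zero_iff P κ (measurable_one.sub hg)).1 h0] with ω hω
  filter_upwards [hω] with x hx
  exact (hle (ω, x)).antisymm (tsub_eq_zero_iff_le.1 hx)

variable [IsSFiniteKernel η]

lemma IsFlowAdaptedDensity.weightedIntensity_outflow_eq (hF : IsFlowAdaptedDensity θ F)
    (hP : ∀ s, MeasurePreserving (θ s) P P) (hκ : ∀ s ω, κ (θ s ω) = shiftMeasure s (κ ω))
    (hη : ∀ s ω, η (θ s ω) = shiftMeasure s (η ω)) :
    weightedIntensity P κ (outflow η F)
      = weightedIntensity P η (outflow κ fun ω => Function.swap (F ω)) := by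
  rw [← fst_weightedIntensity_prod P κ η hF.measurable,
    ← snd_weightedIntensity_prod P κ η hF.measurable]
  refine fst_eq_snd_of_map_add_eq_self volume fun s =>
    map_weightedIntensity_eq_self P _ hF.measurable (hP s) (by fun_prop) (fun ω => ?_)
      fun ω p => hF.flowAdapted s ω p.1 p.2
  rw [Kernel.prod_apply, Kernel.prod_apply, ← Measure.map_prod_map _ _ (by fun_prop) (by fun_prop),
    hκ, hη, map_add_shiftMeasure, map_add_shiftMeasure]

lemma IsFlowAdaptedDensity.weightedIntensity_one_sub_outflow_eq (hF : IsFlowAdaptedDensity θ F)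
    (hP : ∀ s, MeasurePreserving (θ s) P P) (hκ : ∀ s ω, κ (θ s ω) = shiftMeasure s (κ ω))
    (hη : ∀ s ω, η (θ s ω) = shiftMeasure s (η ω))
    (hκη : weightedIntensity P κ 1 = weightedIntensity P η 1)
    [SigmaFinite (weightedIntensity P κ 1)] (hsite : outflow η F ≤ 1)
    (hcenter : (outflow κ fun ω => Function.swap (F ω)) ≤ 1) :
    weightedIntensity P κ (1 - outflow η F)
      = weightedIntensity P η (1 - outflow κ fun ω => Function.swap (F ω)) := by
  have hκ1 := weightedIntensity_sub_add_self P κ (measurable_outflow η hF.measurable)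
    measurable_one hsite
  have hη1 := weightedIntensity_sub_add_self P η (measurable_outflow κ hF.swap.measurable)
    measurable_one hcenter
  have : SigmaFinite (weightedIntensity P κ (outflow η F)) :=
    Measure.sigmaFinite_of_le (weightedIntensity P κ 1) (hκ1 ▸ Measure.le_add_left le_rfl)
  refine (Measure.add_left_inj (weightedIntensity P κ (outflow η F)) _ _).1 ?_
  rw [hκ1, hκη, ← hη1, hF.weightedIntensity_outflow_eq hP hκ hη]

end Deficit

lemma IsErgodicRandomMeasure.measurePreserving {Φ : Ω → Measure (Sp d)}
    (hΦ : IsErgodicRandomMeasure θ P Φ) (s : Sp d) : MeasurePreserving (θ s) P P :=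
  ⟨θ.measurable'.comp measurable_prodMk_right, hΦ.stationary s⟩

/- Almost surely, either all sites are exhausted or some site is not. In the second case the unused
capacity of the centers has finite expectation, so that it vanishes by stationarity, and mass
transport carries this over to the sites. -/
lemma IsFlowAdaptedDensity.ae_isBalancing (hd : 0 < d) (hF : IsFlowAdaptedDensity θ F)
    (hκ : IsErgodicRandomMeasure θ P κ) (hη : IsErgodicRandomMeasure θ P η) {lam C : ℝ≥0∞}
    (hlam : lam ≠ ∞) (hκlam : HasIntensity P κ lam) (hηlam : HasIntensity P η lam)
    (hsub : ∀ ω, IsSubBalancing (κ ω) (η ω) (F ω)) (hC : C ≠ ∞)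
    (hdeficit : ∀ ω x, ∫⁻ ξ, F ω x ξ ∂(η ω) ≠ 1 →
      ∫⁻ ξ, (1 - ∫⁻ y, F ω y ξ ∂(κ ω)) ∂(η ω) ≤ C) :
    ∀ᵐ ω ∂P, IsBalancing (κ ω) (η ω) (F ω) := by
  have := hκ.isProbability
  have := hκ.locallyFinite
  have := hη.locallyFinite
  have := sigmaFinite_weightedIntensity_one hlam hκlam
  have hP := hκ.measurePreserving
  set site := outflow η F
  set center := outflow κ fun ω => Function.swap (F ω)
  have hsite : Measurable site := measurable_outflow η hF.measurable
  have hcenter : Measurable center := measurable_outflow κ hF.swap.measurable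
  have hsite_le : site ≤ 1 := fun p => (hsub p.1).site_le p.2
  have hcenter_le : center ≤ 1 := fun p => (hsub p.1).center_le p.2
  have heq : weightedIntensity P κ (1 - site) = weightedIntensity P η (1 - center) :=
    hF.weightedIntensity_one_sub_outflow_eq hP hκ.flowAdapted hη.flowAdapted
      ((weightedIntensity_one_eq_smul_volume hκlam).trans
        (weightedIntensity_one_eq_smul_volume hηlam).symm) hsite_le hcenter_le
  have h0 : weightedIntensity P κ (1 - site) = 0 := by
    rcases weightedIntensity_eq_zero_or_ae_exists_ne_zero hκ.ergodic hκ.flowAdapted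
      (measurable_one.sub hsite) (hF.one_sub_outflow_flow hη.flowAdapted) with h | hex
    · exact h
    · have hle : ∀ᵐ ω ∂P, ∫⁻ ξ, (1 - center) (ω, ξ) ∂(η ω) ≤ C := by
        filter_upwards [hex] with ω ⟨x, hx⟩
        exact hdeficit ω x fun h1 => hx (tsub_eq_zero_of_le h1.ge)
      exact heq.trans (weightedIntensity_eq_zero_of_ae_lintegral_le hd hP hη.flowAdapted
        (measurable_one.sub hcenter) (hF.swap.one_sub_outflow_flow hκ.flowAdapted) hC hle)
  filter_upwards [ae_ae_eq_one_of_weightedIntensity_one_sub_eq_zero hsite hsite_le h0,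
    ae_ae_eq_one_of_weightedIntensity_one_sub_eq_zero hcenter hcenter_le (heq ▸ h0)]
    with ω hω_site hω_center
  exact ⟨hsub ω, hω_site, hω_center⟩

end FlowAdapted

end GaleShapley

end

theorem theorem3p5 {d : ℕ} (hd : 0 < d) {Ω : Type*} [MeasurableSpace Ω]
    (θ : GaleShapley.MeasurableFlow d Ω) (ℙ : Measure Ω)
    (Φ Ψ : Ω → Measure (GaleShapley.Sp d))
    (hΦ : GaleShapley.IsErgodicRandomMeasure θ ℙ Φ)
    (hΨ : GaleShapley.IsErgodicRandomMeasure θ ℙ Ψ)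
    (lam : ℝ≥0∞) (hlam_pos : 0 < lam) (hlam_fin : lam < ∞)
    (hΦlam : GaleShapley.HasIntensity ℙ Φ lam)
    (hΨlam : GaleShapley.HasIntensity ℙ Ψ lam) :
    (∀ᵐ ω ∂ℙ,
      GaleShapley.IsConstrained (Φ ω) (Ψ ω) (GaleShapley.siteOptimalDensity (Φ ω) (Ψ ω)) ∧
      GaleShapley.IsBalancing (Φ ω) (Ψ ω) (GaleShapley.siteOptimalDensity (Φ ω) (Ψ ω))) ∧
    GaleShapley.IsFlowAdaptedDensity θ
      (fun ω => GaleShapley.siteOptimalDensity (Φ ω) (Ψ ω)) ∧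
    GaleShapley.IsFlowAdaptedKernel θ
      (fun ω => GaleShapley.densityKernel (Ψ ω)
        (GaleShapley.siteOptimalDensity (Φ ω) (Ψ ω))) ∧
    (∀ᵐ ω ∂ℙ, GaleShapley.IsBalancingTransportKernel (Φ ω) (Ψ ω)
      (GaleShapley.densityKernel (Ψ ω)
        (GaleShapley.siteOptimalDensity (Φ ω) (Ψ ω)))) := by
  obtain ⟨κ, rfl⟩ : ∃ κ : ProbabilityTheory.Kernel Ω (GaleShapley.Sp d), ⇑κ = Φ :=
    ⟨⟨Φ, hΦ.measurable⟩, rfl⟩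
  obtain ⟨η, rfl⟩ : ∃ η : ProbabilityTheory.Kernel Ω (GaleShapley.Sp d), ⇑η = Ψ :=
    ⟨⟨Ψ, hΨ.measurable⟩, rfl⟩
  have := hΦ.locallyFinite
  have := hΨ.locallyFinite
  have hconstrained (ω : Ω) := GaleShapley.isConstrained_siteOptimalDensity (κ ω) (η ω)
  have hadapted :=
    GaleShapley.isFlowAdaptedDensity_siteOptimalDensity hΦ.flowAdapted hΨ.flowAdapted
  have hbalancing := hadapted.ae_isBalancing hd hΦ hΨ hlam_fin.ne hΦlam hΨlam
    (fun ω => (hconstrained ω).toIsSubBalancing) ENNReal.one_ne_top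
    fun ω _ hx => GaleShapley.lintegral_center_deficit_le_one (κ ω) (η ω) hx
  exact ⟨hbalancing.mono fun ω hω => ⟨hconstrained ω, hω⟩, hadapted,
    GaleShapley.isFlowAdaptedKernel_densityKernel hΨ.flowAdapted hadapted,
    hbalancing.mono fun _ hω => hω.isBalancingTransportKernel_densityKernel⟩
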